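/- Let $x$ be a point of a smooth complex curve and fix a formal coordinate $z$ at $x$, so that $\mathcal O_x=\mathbf C[[z]]$ and $\mathcal K_x=\mathbf C((z))$. Let $n\ge 0$. Let $\mathcal D(\mathcal K_x)$ (resp. $\mathcal D(\mathcal O_x)$) be the algebra of differential operators $\sum_{j\le m}a_j\partial^j$, $\partial=d/dz$, with $a_j\in\mathcal K_x$ (resp. $a_j\in\mathcal O_x$); $\mathcal D(\mathcal K_x)$ carries the direct limit, over the order $m$, of the linear $z$-adic topologies on the spaces of operators of order $\le m$. Let $\mathfrak g=\mathcal D(\mathcal K_x)\otimes\mathfrak{gl}_n=\mathrm{Mat}_n(\mathcal D(\mathcal K_x))$ with the commutator bracket. For a $\mathbf C$-algebra $R$, let $\mathbf{Gr}_{\mathcal D^n}(x)(R)$ be the set of pairs $(M,\iota)$, where $M$ is an $R$-flat, finitely presented right $R\otimes\mathcal D(\mathcal O_x)$-module with torsion-free fibers over $\operatorname{Spec}R$, and $\iota:M[z^{-1}]\cong (R\otimes\mathcal D(\mathcal K_x))^n$ is an isomorphism such that $M\to (R\otimes\mathcal D(\mathcal K_x))^n$ is injective with $R$-flat cokernel;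 thus $M$ is a submodule of $(R\otimes\mathcal D(\mathcal K_x))^n$. (This is the fiber at $x$ of the adèlic Grassmannian of $\mathcal D^n$: modifications of $\mathcal D^n$ at $x$ are local at $x$.) Its unit point is $\mathcal D^n=\mathcal D(\mathcal O_x)^n$. Let $\mathbf{Gr}(\mathcal K_x^n)(R)$ be the set of $R$-points of the thin Sato Grassmannian: $R$-submodules $L\subset R\otimes\mathcal K_x^n$ with $R\otimes z^k\mathcal O_x^n\subset L\subset R\otimes z^{-k}\mathcal O_x^n$ for some $k$ and with $(R\otimes \mathcal K_x^n)/L$ projective over $R$. The tangent space $T_M\mathbf{Gr}_{\mathcal D^n}(x)$ at an $R$-point $M$ is the set of $R[\varepsilon]$-points ($\varepsilon^2=0$) reducing to $M$, with its canonical addition and scalar multiplication. Then: 1. The de Rham functor $M\mapsto h(M)=M\otimes_{\mathcal D}\mathcal O$, i.e. the $R$-span of all $m(f)$ with $m\in M$, $f\in\mathcal O_x$, is a bijection $\mathbf{Gr}_{\mathcal D^n}(x)(R)\to\mathbf{Gr}(\mathcal K_x^n)(R)$, natural in $R$ and equivariant for the infinitesimal actions $1+e\xi$ ($\xi\in\mathfrak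 g$, $e\in R$, $e^2=0$) on both sides. 2. $\mathfrak g$ acts on $\mathbf{Gr}_{\mathcal D^n}(x)$ as a Lie algebra of vector fields: for $e\in R$ with $e^2=0$ and $\xi\in\mathfrak g$ the map $M\mapsto(1+e\xi)M$ preserves $\mathbf{Gr}_{\mathcal D^n}(x)(R)$, is natural in $(R,e)$, is the identity for $e=0$, is additive in $\xi$ and compatible with scalars, and the commutator of $1+e\xi$ and $1+e'\eta$ is $1+ee'[\xi,\eta]$ if $e^2=e'^2=0$. 3. The action is continuous: for each $k$, the restriction of the vector field $M\mapsto v_\xi(M)=(1+\varepsilon\xi)M[\varepsilon]$ to the points with $z^k\mathcal D^n\subset M\subset z^{-k}\mathcal D^n$ is a locally constant function of $\xi\in\mathfrak g$ (that is, it is continuous for the discrete topology on the space of vector fields along this stratum). 4. The action is formally transitive: for each $\mathbf C$-algebra $R$ and each $R$-point $M$, the map $R\otimes\mathfrak g\to T_M\mathbf{Gr}_{\mathcal D^n}(x)$, $\xi\mapsto (1+\varepsilon\xi)M[\varepsilon]$, is (well defined and) surjective. 5. At the unit point the map $\mathfrak g\to T_{\mathcal D^n}\mathbf{Gr}_{\mathcal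 D^n}(x)$ induces an isomorphism of complex vector spaces $\mathcal D(\mathcal K_x)/\mathcal D(\mathcal O_x)\otimes\mathfrak{gl}_n\cong T_{\mathcal D^n}\mathbf{Gr}_{\mathcal D^n}(x)$. -/

import Mathlib

open scoped TensorProduct Topology

noncomputable section

namespace SatoGr

/-! ### Laurent and Taylor series, differential operators -/

/-- The field `K = ℂ((z))` of Laurent series on the punctured formal disc at the point. (It has its
own name so that the coefficientwise `ℂ`-algebra structure is the only one in sight.) -/
def K : Type := LaurentSeries ℂ

instance : Field K := inferInstanceAs (Field (LaurentSeries ℂ))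

instance : Algebra ℂ K := (HahnSeries.instAlgebra : Algebra ℂ (LaurentSeries ℂ))

/-- The `i`-th coefficient of a Laurent series. -/
def coeff (f : K) (i : ℤ) : ℂ := HahnSeries.coeff (f : LaurentSeries ℂ) i

theorem coeff_add (f g : K) (i : ℤ) : coeff (f + g) i = coeff f i + coeff g i := rfl

theorem coeff_smul (c : ℂ) (f : K) (i : ℤ) : coeff (c • f) i = c * coeff f i :=
  rfl

/-- The monomial `z^k`. -/
def zpow (k : ℤ) : K := (HahnSeries.single k (1 : ℂ) : LaurentSeries ℂ)

/-- The subspace `z^k ℂ[[z]] ⊆ ℂ((z))`; for `k = 0` this is `O = ℂ[[z]]`. -/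
def lat (k : ℤ) : Submodule ℂ K where
  carrier := {f | ∀ i < k, coeff f i = 0}
  zero_mem' := fun _ _ => rfl
  add_mem' := fun {f g} hf hg i hi => by rw [coeff_add, hf i hi, hg i hi, add_zero]
  smul_mem' := fun c f hf i hi => by rw [coeff_smul, hf i hi, mul_zero]

/-- The derivation `∂ = d/dz` of `ℂ((z))`. -/
def ddz : Module.End ℂ K where
  toFun f := LaurentSeries.hasseDeriv ℂ 1 (f : LaurentSeries ℂ)
  map_add' f g := map_add (LaurentSeries.hasseDeriv ℂ 1) (f : LaurentSeries ℂ) g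
  map_smul' c f := by
    refine HahnSeries.ext (funext fun i => ?_)
    refine (LaurentSeries.hasseDeriv_coeff 1 _ i).trans ?_
    refine Eq.trans (mul_smul_comm (Ring.choose (i + ((1 : ℕ) : ℤ)) 1) c
      (coeff f (i + ((1 : ℕ) : ℤ)))).symm ?_
    exact congrArg (c * ·) (LaurentSeries.hasseDeriv_coeff 1 (f : LaurentSeries ℂ) i).symm

theorem coeff_ddz (f : K) (i : ℤ) : coeff (ddz f) i = (i + 1) * coeff f (i + 1) := by
  have h : coeff (ddz f) i = Ring.choose (i + ((1 : ℕ) : ℤ)) 1 • coeff f (i + ((1 : ℕ) : ℤ)) :=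
    LaurentSeries.hasseDeriv_coeff 1 (f : LaurentSeries ℂ) i
  rw [h, Ring.choose_one_right]
  simp

/-- Multiplication by a Laurent series. -/
def mulOp (f : K) : Module.End ℂ K := LinearMap.mulLeft ℂ f

/-- The algebra `D(K)` of differential operators `∑ aⱼ ∂ʲ` (finite sums) with Laurent series
coefficients, realised faithfully on `K`. -/
def diffOps : Subalgebra ℂ (Module.End ℂ K) :=
  Algebra.adjoin ℂ (Set.range mulOp ∪ {ddz})

/-- `D(K)` as a `ℂ`-algebra. -/
def DK : Type := ↥diffOps

instance : Ring DK := inferInstanceAs (Ring ↥diffOps)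

instance : Algebra ℂ DK := inferInstanceAs (Algebra ℂ ↥diffOps)

/-- The tautological action of `D(K)` on `K`. -/
def act : DK →ₐ[ℂ] Module.End ℂ K := diffOps.val

/-- The subalgebra `D(O) ⊆ D(K)` of differential operators with Taylor series coefficients. -/
def DO : Subalgebra ℂ DK :=
  Algebra.adjoin ℂ {P | (∃ f ∈ lat 0, act P = mulOp f) ∨ act P = ddz}

/-- Multiplication by a Laurent series, as an element of `D(K)`. -/
def mulD (f : K) : DK := ⟨mulOp f, Algebra.subset_adjoin (Or.inl ⟨f, rfl⟩)⟩

/-- `∂` as an element of `D(K)`. -/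
def ddzD : DK := ⟨ddz, Algebra.subset_adjoin (Or.inr rfl)⟩

/-! ### The topology of `D(K)` and the Lie algebra `D(K) ⊗ gl_n` -/

/-- The operators `∑_{j ≤ m} aⱼ ∂ʲ` with all `aⱼ ∈ z^N ℂ[[z]]`. -/
def smallOps (m : ℕ) (N : ℤ) : Submodule ℂ DK :=
  Submodule.span ℂ {P | ∃ j ≤ m, ∃ a ∈ lat N, P = mulD a * ddzD ^ j}

/-- A subspace of `D(K)` is open when its intersection with each space of operators of order
`≤ m` is open for the `z`-adic topology on coefficients. -/
def IsOpenSubspace (U : Submodule ℂ DK) : Prop :=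
  ∀ m : ℕ, ∃ N : ℤ, smallOps m N ≤ U

theorem smallOps_anti (m : ℕ) {N N' : ℤ} (h : N ≤ N') : smallOps m N' ≤ smallOps m N := by
  refine Submodule.span_mono ?_
  rintro P ⟨j, hj, a, ha, rfl⟩
  exact ⟨j, hj, a, fun i hi => ha i (lt_of_lt_of_le hi h), rfl⟩

theorem IsOpenSubspace.inf {U V : Submodule ℂ DK} (hU : IsOpenSubspace U)
    (hV : IsOpenSubspace V) : IsOpenSubspace (U ⊓ V) := by
  intro m
  obtain ⟨N, hN⟩ := hU m
  obtain ⟨N', hN'⟩ := hV m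
  exact ⟨max N N', le_inf ((smallOps_anti m (le_max_left _ _)).trans hN)
    ((smallOps_anti m (le_max_right _ _)).trans hN')⟩

/-- The natural topology of `D(K)`: the linear topology which is the direct limit, over the order
`m`, of the `z`-adic topologies on the spaces of operators of order `≤ m`. -/
instance : TopologicalSpace DK where
  IsOpen s := ∀ P ∈ s, ∃ U, IsOpenSubspace U ∧ ∀ Q ∈ U, P + Q ∈ s
  isOpen_univ := fun _ _ => ⟨⊤, fun _ => ⟨0, le_top⟩, fun _ _ => trivial⟩
  isOpen_inter := by
    rintro s t hs ht P ⟨hPs, hPt⟩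
    obtain ⟨U, hU, hUs⟩ := hs P hPs
    obtain ⟨V, hV, hVt⟩ := ht P hPt
    exact ⟨U ⊓ V, hU.inf hV, fun Q hQ => ⟨hUs Q hQ.1, hVt Q hQ.2⟩⟩
  isOpen_sUnion := by
    rintro S hS P ⟨s, hs, hP⟩
    obtain ⟨U, hU, hUs⟩ := hS s hs P hP
    exact ⟨U, hU, fun Q hQ => ⟨s, hs, hUs Q hQ⟩⟩

/-- The Lie algebra `D(K) ⊗ gl_n`, that is, `n × n` matrices over the associative algebra `D(K)`
with the commutator bracket (and the product topology). -/
abbrev DGl (n : ℕ) : Type := Matrix (Fin n) (Fin n) DK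

/-! ### Base change to a `ℂ`-algebra `R` -/

section BaseChange

variable (R : Type) [CommRing R] [Algebra ℂ R]

/-- `R ⊗ D(K)`. -/
abbrev DKR : Type := R ⊗[ℂ] DK

/-- `R ⊗ K`. -/
abbrev KR : Type := R ⊗[ℂ] K

/-- `R ⊗ D(O)`, as a subalgebra of `R ⊗ D(K)`. -/
def DOR : Subalgebra R (DKR R) :=
  (Algebra.TensorProduct.map (AlgHom.id R R) DO.val).range

/-- The right `R ⊗ D(O)`-submodules of `(R ⊗ D(K))^n`. -/
abbrev DSub (n : ℕ) : Type := Submodule (DOR R).op (Fin n → DKR R)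

/-- The function `z^k` in `R ⊗ D(K)`. -/
def zpowR (k : ℤ) : DKR R := 1 ⊗ₜ mulD (zpow k)

/-- `R ⊗ D(K)` acts on `R ⊗ K` by `R`-linear differential operators. -/
def actK : DKR R →ₐ[R] Module.End R (KR R) :=
  Algebra.TensorProduct.lift (Algebra.ofId R _)
    ((Module.End.baseChangeHom ℂ R K).comp act)
    (fun r _ => Algebra.commutes r _)

variable {R}

/-- Left multiplication of columns in `(R ⊗ D(K))^n` by a matrix; it commutes with the right
action of differential operators. -/
def leftMul {n : ℕ} (g : Matrix (Fin n) (Fin n) (DKR R)) :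
    (Fin n → DKR R) →ₗ[(DOR R).op] (Fin n → DKR R) where
  toFun v := g.mulVec v
  map_add' := Matrix.mulVec_add g
  map_smul' := by
    intro P v
    funext i
    change ∑ j, g i j * (v j * P.1.unop) = (∑ j, g i j * v j) * P.1.unop
    simp only [Finset.sum_mul, mul_assoc]

/-- The action of a matrix of differential operators on `(R ⊗ K)^n`. -/
def matActK {n : ℕ} (g : Matrix (Fin n) (Fin n) (DKR R)) :
    (Fin n → KR R) →ₗ[R] (Fin n → KR R) :=
  LinearMap.pi fun i => ∑ j, (actK R (g i j)).comp (LinearMap.proj j)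

end BaseChange

/-! ### The fiber of the adèlic Grassmannian -/

section Grassmannian

variable {R : Type} [CommRing R] [Algebra ℂ R] {n : ℕ}

/-- The `R`-points of the fiber at the point of the adèlic Grassmannian of `D^n`, on the disc
`Spec O`: pairs of an `R`-flat locally finitely presented right `D`-module `M` and an isomorphism
`ι` of `M` with `D^n` away from the point (i.e. after inverting `z`), such that
`M → M[1/z] ≅ (R ⊗ D(K))^n` is injective with `R`-flat cokernel. By injectivity, `(M, ι)` is a
right `R ⊗ D(O)`-submodule of `(R ⊗ D(K))^n`. As the cokernel is flat, the fiber of `M` at a point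
of `Spec R` with residue field `k` is a submodule of `(k ⊗ D(K))^n`, hence torsion-free. -/
structure IsGrD (M : DSub R n) : Prop where
  flat : Module.Flat R (M.restrictScalars R)
  finitePresentation : Module.FinitePresentation (DOR R).op M
  iso_off_point : ∀ v : Fin n → DKR R, ∃ N : ℕ, (fun i => v i * zpowR R N) ∈ M
  flat_coker : Module.Flat R ((Fin n → DKR R) ⧸ M.restrictScalars R)

/-- The filtration of the ind-scheme: `z^k D^n ⊆ M ⊆ z^{-k} D^n`. -/
def InStratum (k : ℕ) (M : DSub R n) : Prop :=
  (∀ v : Fin n → DKR R, (∀ i, v i ∈ DOR R) → (fun i => zpowR R k * v i) ∈ M) ∧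
  (∀ v ∈ M, ∀ i, zpowR R k * v i ∈ DOR R)

variable (R n) in
/-- The unit point `D^n`. -/
def unitPt : DSub R n where
  carrier := {v | ∀ i, v i ∈ DOR R}
  zero_mem' := fun _ => zero_mem _
  add_mem' := fun hv hw i => add_mem (hv i) (hw i)
  smul_mem' := fun P _ hv i => mul_mem (hv i) P.2

/-- Base change of a submodule along a morphism of `ℂ`-algebras. -/
def push {S : Type} [CommRing S] [Algebra ℂ S] (f : R →ₐ[ℂ] S) (M : DSub R n) : DSub S n :=
  Submodule.span (DOR S).op
    ((fun v i => Algebra.TensorProduct.map f (AlgHom.id ℂ DK) (v i)) '' (M : Set (Fin n → DKR R)))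

/-- The matrix `1 + e ξ` over `R ⊗ D(K)`, for a scalar `e ∈ R`. -/
def onePlus (e : R) (ξ : Matrix (Fin n) (Fin n) (DKR R)) : Matrix (Fin n) (Fin n) (DKR R) :=
  1 + e • ξ

/-- Extension of scalars of a matrix of differential operators along `R → S`. -/
def matMap {S : Type} [CommRing S] [Algebra ℂ S] (f : R →ₐ[ℂ] S)
    (ξ : Matrix (Fin n) (Fin n) (DKR R)) : Matrix (Fin n) (Fin n) (DKR S) :=
  ξ.map (Algebra.TensorProduct.map f (AlgHom.id ℂ DK))

variable (R) in
/-- A matrix over `D(K)` as a matrix over `R ⊗ D(K)`. -/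
def constMat (ξ : DGl n) : Matrix (Fin n) (Fin n) (DKR R) := ξ.map fun P => 1 ⊗ₜ P

/-- For `e² = 0`, the infinitesimal automorphism `1 + e ξ`, `ξ ∈ D(K) ⊗ gl_n`, applied to `M`. -/
def infAct (e : R) (ξ : DGl n) (M : DSub R n) : DSub R n :=
  M.map (leftMul (onePlus e (constMat R ξ)))

/-- `D(K) ⊗ gl_n` acts on the functor of points of the fiber as a Lie algebra of vector fields:
`ξ ↦ 1 + e ξ` (for all square-zero `e`) is a Lie algebra homomorphism from `D(K) ⊗ gl_n` to the
Lie algebra of the group functor of automorphisms. The bracket of the latter is given by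
commutators of `1 + e ξ` and `1 + e' η`. -/
structure IsLieAction (n : ℕ) : Prop where
  preserves : ∀ (R : Type) [CommRing R] [Algebra ℂ R] (e : R) (ξ : DGl n) (M : DSub R n),
    e * e = 0 → IsGrD M → IsGrD (infAct e ξ M)
  natural : ∀ (R S : Type) [CommRing R] [Algebra ℂ R] [CommRing S] [Algebra ℂ S]
    (f : R →ₐ[ℂ] S) (e : R) (ξ : DGl n) (M : DSub R n),
    e * e = 0 → IsGrD M → push f (infAct e ξ M) = infAct (f e) ξ (push f M)
  at_zero : ∀ (R : Type) [CommRing R] [Algebra ℂ R] (ξ : DGl n) (M : DSub R n),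
    IsGrD M → infAct 0 ξ M = M
  add : ∀ (R : Type) [CommRing R] [Algebra ℂ R] (e : R) (ξ η : DGl n) (M : DSub R n),
    e * e = 0 → IsGrD M → infAct e (ξ + η) M = infAct e ξ (infAct e η M)
  smul : ∀ (R : Type) [CommRing R] [Algebra ℂ R] (e : R) (c : ℂ) (ξ : DGl n) (M : DSub R n),
    e * e = 0 → IsGrD M → infAct e (c • ξ) M = infAct (c • e) ξ M
  lie : ∀ (R : Type) [CommRing R] [Algebra ℂ R] (e e' : R) (ξ η : DGl n) (M : DSub R n),
    e * e = 0 → e' * e' = 0 → IsGrD M →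
    infAct e ξ (infAct e' η M) = infAct (e * e') (ξ * η - η * ξ) (infAct e' η (infAct e ξ M))

/-! ### Tangent spaces -/

variable (R) in
/-- `R[ε] → R`, `ε ↦ 0`. -/
def epsZero : DualNumber R →ₐ[ℂ] R := TrivSqZeroExt.fstHom ℂ R R

variable (R) in
/-- `R → R[ε]`. -/
def epsIncl : R →ₐ[ℂ] DualNumber R := TrivSqZeroExt.inlAlgHom ℂ R R

/-- The tangent space at an `R`-point `M`: the `R[ε]`-points reducing to `M` modulo `ε`. -/
def TangentSpace (M : DSub R n) : Type :=
  {τ : DSub (DualNumber R) n // IsGrD τ ∧ push (epsZero R) τ = M}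

/-- The value `(1 + ε ξ) M[ε]` at `M` of the vector field of `ξ ∈ R ⊗ D(K) ⊗ gl_n`. -/
def tangentVec (ξ : Matrix (Fin n) (Fin n) (DKR R)) (M : DSub R n) : DSub (DualNumber R) n :=
  (push (epsIncl R) M).map (leftMul (onePlus DualNumber.eps (matMap (epsIncl R) ξ)))

variable (R) in
/-- The algebra map `R[ε₁, ε₂]/(ε₁, ε₂)² → R[ε]`, `ε₁ ↦ a ε`, `ε₂ ↦ b ε`. -/
def epsPair (a b : R) : TrivSqZeroExt R (R × R) →ₐ[ℂ] DualNumber R :=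
  (TrivSqZeroExt.map (R' := R)
    (a • LinearMap.fst R R R + b • LinearMap.snd R R R)).restrictScalars ℂ

variable (R) in
/-- The algebra map `R[ε] → R[ε]`, `ε ↦ c ε`. -/
def epsScale (c : R) : DualNumber R →ₐ[ℂ] DualNumber R :=
  (TrivSqZeroExt.map (R' := R) (c • (LinearMap.id : R →ₗ[R] R))).restrictScalars ℂ

/-- `τ = τ₁ + τ₂` for the canonical addition on the tangent space of a functor: there is exactly
one point over `R[ε₁, ε₂]/(ε₁, ε₂)²` that restricts to `τ₁` (for `ε₂ = 0`) and to `τ₂` (for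
`ε₁ = 0`), and it restricts to `τ` for `ε₁ = ε₂ = ε`. -/
def IsTangentAdd {M : DSub R n} (τ₁ τ₂ τ : TangentSpace M) : Prop :=
  ∃ σ : DSub (TrivSqZeroExt R (R × R)) n,
    (IsGrD σ ∧ push (epsPair R 1 0) σ = τ₁.1 ∧ push (epsPair R 0 1) σ = τ₂.1) ∧
    (∀ σ' : DSub (TrivSqZeroExt R (R × R)) n, IsGrD σ' → push (epsPair R 1 0) σ' = τ₁.1 →
      push (epsPair R 0 1) σ' = τ₂.1 → σ' = σ) ∧
    push (epsPair R 1 1) σ = τ.1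

/-- `τ' = c τ` for the canonical scalar multiplication, by functoriality under `ε ↦ c ε`. -/
def IsTangentSMul {M : DSub R n} (c : R) (τ τ' : TangentSpace M) : Prop :=
  push (epsScale R c) τ.1 = τ'.1

/-! ### The thin Sato Grassmannian -/

variable (R n) in
/-- `(R ⊗ z^k O)^n ⊆ (R ⊗ K)^n`. -/
def latR (k : ℤ) : Submodule R (Fin n → KR R) :=
  Submodule.pi Set.univ fun _ => (lat k).baseChange R

/-- The `R`-points of the thin Sato Grassmannian of `K^n`: families over `R` of subspaces
commensurable with `O^n`, that is, `R`-submodules between some `z^k O^n` and `z^{-k} O^n` with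
projective quotient. -/
structure IsSato (L : Submodule R (Fin n → KR R)) : Prop where
  commensurable : ∃ k : ℕ, latR R n k ≤ L ∧ L ≤ latR R n (-k)
  projective_coker : Module.Projective R ((Fin n → KR R) ⧸ L)

/-- Base change along a morphism of `ℂ`-algebras. -/
def pushK {S : Type} [CommRing S] [Algebra ℂ S] (f : R →ₐ[ℂ] S)
    (L : Submodule R (Fin n → KR R)) : Submodule S (Fin n → KR S) :=
  Submodule.span S
    ((fun v i => TensorProduct.map f.toLinearMap (LinearMap.id : K →ₗ[ℂ] K) (v i)) ''
      (L : Set (Fin n → KR R)))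

/-- The de Rham functor `M ↦ h(M) = M ⊗_D O`, as the subspace of `(R ⊗ K)^n` spanned by the
`m(f)`, `m ∈ M`, `f ∈ O`. -/
def deRham (M : DSub R n) : Submodule R (Fin n → KR R) :=
  Submodule.span R {w | ∃ m ∈ M, ∃ f ∈ lat 0, w = fun i => actK R (m i) (1 ⊗ₜ f)}

/-- The de Rham functor identifies the fiber of the adèlic Grassmannian with the thin Sato
Grassmannian, compatibly with base change and with the natural infinitesimal actions of
`D(K) ⊗ gl_n` on both sides. -/
structure IsSatoIdentification (n : ℕ) : Prop where
  push_mem : ∀ (R S : Type) [CommRing R] [Algebra ℂ R] [CommRing S] [Algebra ℂ S]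
    (f : R →ₐ[ℂ] S) (M : DSub R n), IsGrD M → IsGrD (push f M)
  bijective : ∀ (R : Type) [CommRing R] [Algebra ℂ R],
    Set.BijOn (deRham : DSub R n → _) {M | IsGrD M} {L | IsSato L}
  natural : ∀ (R S : Type) [CommRing R] [Algebra ℂ R] [CommRing S] [Algebra ℂ S]
    (f : R →ₐ[ℂ] S) (M : DSub R n), IsGrD M → deRham (push f M) = pushK f (deRham M)
  equivariant : ∀ (R : Type) [CommRing R] [Algebra ℂ R] (e : R) (ξ : DGl n) (M : DSub R n),
    e * e = 0 → IsGrD M →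
    deRham (infAct e ξ M) = (deRham M).map (matActK (onePlus e (constMat R ξ)))

end Grassmannian

end SatoGr

end

noncomputable section

namespace SatoGr

/-! ### Laurent series -/

/-! Two facts carry the theorem. The first is that a point `M` is recovered from its de Rham image:
a column `v` lies in `M` iff `v` maps `O` into `h(M)` (`mem_of_vact_mem_deRham`). This is a local
form of Kashiwara's theorem: since `D^n/M` is `z`-power torsion, one can divide by `∂` and use the
eigenvalues of the Euler operator.

The second is that differential operators realise every `R`-linear map between the finite windows
`z^{-k}O^n / z^k O^n`, because Lagrange polynomials in `z∂` project to single monomials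
(`exists_monomialProj`, `exists_matActK_window`). Hence a point of either Grassmannian has the form
`E z^{-k} + z^k`, where `E` is a matrix of operators that is idempotent modulo operators from
`z^{-k}` to `z^k` (`IsIdem`). On the Sato side the idempotent comes from splitting the projective
quotient. On the `D`-module side it comes from finite generation and the equational criterion of
flatness (`IsGrD.exists_isIdem_deRham`). Conversely every such `E` gives a point on both sides, with
matching de Rham image, and approximate idempotents survive base change. This yields the
identification and its naturality.

For tangent vectors, write the idempotent over a square-zero thickening as `E + δ`, with `E`
constant and `δ` nilpotent. The automorphism `1 + [δ, E]` carries the lattice of `E` to that of `E +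
δ` (`IsIdem.idemD_add`), so every deformation comes from the Lie algebra. Continuity holds because
operators sending `z^{-k}O` to `z^k O` form an open subspace and act trivially on the stratum. At
the unit point, two matrices give the same tangent vector exactly when they differ by a matrix over
`D(O)` (`map_unitPt_eq_iff`). -/

theorem K_ext {f g : K} (h : ∀ i, coeff f i = coeff g i) : f = g :=
  HahnSeries.ext (funext h)

/-- The `i`-th coefficient as a linear functional. -/
def coeffL (i : ℤ) : K →ₗ[ℂ] ℂ where
  toFun f := coeff f i
  map_add' f g := coeff_add f g i
  map_smul' c f := coeff_smul c f i

theorem coeff_sub (f g : K) (i : ℤ) : coeff (f - g) i = coeff f i - coeff g i :=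
  map_sub (coeffL i) f g

theorem coeff_sum {ι : Type*} (s : Finset ι) (f : ι → K) (i : ℤ) :
    coeff (∑ j ∈ s, f j) i = ∑ j ∈ s, coeff (f j) i :=
  map_sum (coeffL i) f s

theorem coeff_zpow (k i : ℤ) : coeff (zpow k) i = if i = k then 1 else 0 := by
  unfold coeff zpow
  by_cases h : i = k
  · subst h; rw [HahnSeries.coeff_single_same, if_pos rfl]
  · rw [HahnSeries.coeff_single_of_ne h, if_neg h]

theorem coeff_zpow_mul (k : ℤ) (f : K) (i : ℤ) : coeff (zpow k * f) i = coeff f (i - k) := by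
  have h := HahnSeries.coeff_single_mul_add (r := (1 : ℂ)) (x := (f : LaurentSeries ℂ))
    (a := i - k) (b := k)
  rw [one_mul, sub_add_cancel] at h
  exact h

theorem zpow_mul_zpow (a b : ℤ) : zpow a * zpow b = zpow (a + b) := by
  refine (HahnSeries.single_mul_single (a := a) (b := b) (r := (1 : ℂ)) (s := 1)).trans ?_
  rw [one_mul]; rfl

theorem zpow_zero' : zpow 0 = 1 := rfl

theorem lat_anti {a b : ℤ} (h : a ≤ b) : lat b ≤ lat a :=
  fun _ hf i hi => hf i (hi.trans_le h)

theorem zpow_mem_lat {a k : ℤ} (h : a ≤ k) : zpow k ∈ lat a := fun i hi => by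
  rw [coeff_zpow, if_neg (by omega)]

theorem mul_mem_lat {a b : ℤ} {f g : K} (hf : f ∈ lat a) (hg : g ∈ lat b) :
    f * g ∈ lat (a + b) := by
  intro i hi
  refine (HahnSeries.coeff_mul (x := (f : LaurentSeries ℂ)) (y := g) (a := i)).trans ?_
  refine Finset.sum_eq_zero fun p hp => ?_
  rw [Finset.mem_antidiagonal] at hp
  by_cases h : p.1 < a
  · exact mul_eq_zero_of_left (hf _ h) _
  · exact mul_eq_zero_of_right _ (hg _ (by omega))

theorem exists_mem_lat (f : K) : ∃ N : ℕ, f ∈ lat (-N) := by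
  refine ⟨(-(HahnSeries.order (f : LaurentSeries ℂ))).toNat, fun i hi => ?_⟩
  exact HahnSeries.coeff_eq_zero_of_lt_order (x := (f : LaurentSeries ℂ)) (by omega)

/-- A Laurent series is a finite sum of monomials up to higher order. -/
theorem sub_window_mem_lat {a : ℤ} {f : K} (hf : f ∈ lat a) (b : ℤ) :
    f - ∑ i ∈ Finset.Ico a b, coeff f i • zpow i ∈ lat b := by
  intro j hj
  rw [coeff_sub, coeff_sum]
  simp only [coeff_smul, coeff_zpow, mul_ite, mul_one, mul_zero, Finset.sum_ite_eq,
    Finset.mem_Ico]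
  by_cases h : a ≤ j
  · simp [h, hj]
  · simp [h, hf j (by omega)]

theorem ddz_mem_lat {a : ℤ} {f : K} (hf : f ∈ lat a) : ddz f ∈ lat (a - 1) := fun i hi => by
  rw [coeff_ddz, hf _ (by omega), mul_zero]

theorem ddz_zpow (k : ℤ) : ddz (zpow k) = (k : ℂ) • zpow (k - 1) := by
  refine K_ext fun i => ?_
  rw [coeff_ddz, coeff_smul, coeff_zpow, coeff_zpow]
  by_cases hi : i = k - 1
  · subst hi; simp
  · rw [if_neg (by omega), if_neg hi, mul_zero, mul_zero]

theorem ddz_zpow_mul (k : ℤ) (f : K) :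
    ddz (zpow k * f) = ddz (zpow k) * f + zpow k * ddz f := by
  rw [ddz_zpow]
  refine K_ext fun i => ?_
  rw [coeff_ddz, coeff_add, smul_mul_assoc, coeff_smul, coeff_zpow_mul, coeff_zpow_mul,
    coeff_zpow_mul, coeff_ddz, show i - (k - 1) = i + 1 - k by ring,
    show i - k + 1 = i + 1 - k by ring]
  push_cast
  ring

/-- The Leibniz rule. -/
theorem ddz_mul (f g : K) : ddz (f * g) = ddz f * g + f * ddz g := by
  obtain ⟨N, hf⟩ := exists_mem_lat f
  obtain ⟨M, hg⟩ := exists_mem_lat g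
  rw [← sub_eq_zero]
  -- `B` is the Leibniz defect in the first argument. It vanishes on monomials and is `z`-adically
  -- continuous, so it vanishes.
  let B : K →ₗ[ℂ] K := ddz ∘ₗ LinearMap.mulRight ℂ g - (LinearMap.mulRight ℂ g ∘ₗ ddz +
    LinearMap.mulRight ℂ (ddz g))
  have hB : ∀ f, B f = ddz (f * g) - (ddz f * g + f * ddz g) := fun f => rfl
  have hsmall : ∀ b : ℤ, ∀ h ∈ lat b, B h ∈ lat (b - M - 1) := by
    intro b h hh
    rw [hB]
    refine sub_mem ?_ (add_mem ?_ ?_)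
    · exact ddz_mem_lat (mul_mem_lat hh hg)
    · exact lat_anti (by omega) (mul_mem_lat (ddz_mem_lat hh) hg)
    · exact lat_anti (by omega) (mul_mem_lat hh (ddz_mem_lat hg))
  have hz : ∀ k, B (zpow k) = 0 := fun k => by rw [hB, ddz_zpow_mul, sub_self]
  refine (hB f).symm.trans (K_ext fun i => ?_)
  -- Truncating `f` at order `i + M + 2` leaves a defect in `lat (i + 1)`, which has no coefficient
  -- at `i`.
  have h := hsmall (i + M + 2) _ (sub_window_mem_lat hf _) i (by omega)
  rw [map_sub, map_sum] at h
  simp only [map_smul, hz, smul_zero, Finset.sum_const_zero, sub_zero] at h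
  exact h

theorem ddz_one : ddz 1 = 0 := by
  rw [← zpow_zero', ddz_zpow]; simp

/-- Every Taylor series has an antiderivative. -/
theorem exists_ddz_eq {f : K} (hf : f ∈ lat 0) : ∃ g ∈ lat 0, ddz g = f := by
  let c : ℤ → ℂ := fun i => if 1 ≤ i then coeff f (i - 1) / i else 0
  have hc : BddBelow (Function.support c) :=
    ⟨0, fun i hi => by
      by_contra h
      exact hi (if_neg (by omega))⟩
  let g : K := (HahnSeries.ofSuppBddBelow c hc : LaurentSeries ℂ)
  have hg : ∀ i, coeff g i = c i := fun i =>
    congrFun (HahnSeries.coeff_ofSuppBddBelow (f := c) (hf := hc)) i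
  refine ⟨g, fun i hi => by rw [hg]; exact if_neg (by omega), K_ext fun i => ?_⟩
  rw [coeff_ddz, hg]
  by_cases h : 0 ≤ i
  · have h' : ((i : ℂ) + 1) ≠ 0 := by exact_mod_cast (by omega : i + 1 ≠ 0)
    simp only [c, if_pos (show 1 ≤ i + 1 by omega), add_sub_cancel_right]
    push_cast
    field_simp
  · simp only [c, if_neg (show ¬ 1 ≤ i + 1 by omega), mul_zero]
    exact (hf i (by omega)).symm

/-! ### Differential operators -/

theorem act_injective : Function.Injective act := Subtype.val_injective

theorem act_mulD (f : K) : act (mulD f) = mulOp f := rfl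

theorem act_ddzD : act ddzD = ddz := rfl

theorem mulOp_apply (f g : K) : mulOp f g = f * g := rfl

/-- Multiplication operators as an algebra homomorphism. -/
def mulDHom : K →ₐ[ℂ] DK where
  toFun := mulD
  map_one' := act_injective (LinearMap.ext fun _ => one_mul _)
  map_mul' f g := act_injective (LinearMap.ext fun _ => mul_assoc f g _)
  map_zero' := act_injective (LinearMap.ext fun _ => zero_mul _)
  map_add' f g := act_injective (LinearMap.ext fun _ => add_mul f g _)
  commutes' c := act_injective (LinearMap.ext fun h => by
    rw [act_mulD, AlgHom.commutes, mulOp_apply, Module.algebraMap_end_apply, Algebra.smul_def])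

theorem mulDHom_apply (f : K) : mulDHom f = mulD f := rfl

theorem ddzD_mul_mulD (f : K) : ddzD * mulD f = mulD f * ddzD + mulD (ddz f) :=
  act_injective (LinearMap.ext fun g => by
    simp only [map_mul, map_add, act_ddzD, act_mulD, Module.End.mul_apply, LinearMap.add_apply,
      mulOp_apply, ddz_mul]
    exact add_comm _ _)

/-- Every differential operator is a sum of terms `a ∂ʲ`. -/
theorem span_mulD_mul_ddzD_pow :
    Submodule.span ℂ {P : DK | ∃ (a : K) (j : ℕ), P = mulD a * ddzD ^ j} = ⊤ := by
  set S := Submodule.span ℂ {P : DK | ∃ (a : K) (j : ℕ), P = mulD a * ddzD ^ j} with hS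
  have hmem : ∀ a j, mulD a * ddzD ^ j ∈ S := fun a j => Submodule.subset_span ⟨a, j, rfl⟩
  have hmul : ∀ a : K, ∀ P ∈ S, mulD a * P ∈ S := by
    intro a P hP
    induction hP using Submodule.span_induction with
    | mem P h =>
      obtain ⟨b, j, rfl⟩ := h
      rw [← mul_assoc, ← mulDHom_apply, ← mulDHom_apply, ← map_mul]
      exact hmem _ _
    | zero => rw [mul_zero]; exact zero_mem _
    | add P Q _ _ hP hQ => rw [mul_add]; exact add_mem hP hQ
    | smul c P _ hP => rw [mul_smul_comm]; exact Submodule.smul_mem _ _ hP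
  have hddz : ∀ P ∈ S, ddzD * P ∈ S := by
    intro P hP
    induction hP using Submodule.span_induction with
    | mem P h =>
      obtain ⟨b, j, rfl⟩ := h
      rw [← mul_assoc, ddzD_mul_mulD, add_mul, mul_assoc, ← pow_succ']
      exact add_mem (hmem _ _) (hmem _ _)
    | zero => rw [mul_zero]; exact zero_mem _
    | add P Q _ _ hP hQ => rw [mul_add]; exact add_mem hP hQ
    | smul c P _ hP => rw [mul_smul_comm]; exact Submodule.smul_mem _ _ hP
  have hone : (1 : DK) ∈ S := by
    have := hmem 1 0
    rwa [← mulDHom_apply, map_one, pow_zero, mul_one] at this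
  -- `S` is stable under left multiplication by the generators, hence is a left ideal; it contains
  -- `1`.
  have key : ∀ T ∈ diffOps, ∀ Q : DK, act Q = T → ∀ P ∈ S, Q * P ∈ S := by
    intro T hT
    induction hT using Algebra.adjoin_induction with
    | mem T h =>
      intro Q hQ
      rcases h with ⟨a, rfl⟩ | h
      · rw [act_injective (hQ.trans (act_mulD a).symm)]
        exact hmul a
      · rw [act_injective ((hQ.trans h).trans act_ddzD.symm)]
        exact hddz
    | algebraMap c =>
      intro Q hQ P hP
      rw [act_injective (hQ.trans (AlgHom.commutes act c).symm), ← Algebra.smul_def]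
      exact Submodule.smul_mem _ _ hP
    | add T U hT hU h1 h2 =>
      intro Q hQ P hP
      let T' : DK := ⟨T, hT⟩
      let U' : DK := ⟨U, hU⟩
      rw [show Q = T' + U' from act_injective (hQ.trans (map_add act T' U').symm), add_mul]
      exact add_mem (h1 T' rfl P hP) (h2 U' rfl P hP)
    | mul T U hT hU h1 h2 =>
      intro Q hQ P hP
      let T' : DK := ⟨T, hT⟩
      let U' : DK := ⟨U, hU⟩
      rw [show Q = T' * U' from act_injective (hQ.trans (map_mul act T' U').symm), mul_assoc]
      exact h1 T' rfl _ (h2 U' rfl P hP)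
  refine eq_top_iff.2 fun P _ => ?_
  have := key _ P.2 P rfl 1 hone
  rwa [mul_one] at this

theorem mulD_mem_DO {f : K} (hf : f ∈ lat 0) : mulD f ∈ DO :=
  Algebra.subset_adjoin (Or.inl ⟨f, hf, rfl⟩)

theorem ddzD_mem_DO : ddzD ∈ DO := Algebra.subset_adjoin (Or.inr rfl)

theorem act_mem_lat_of_mem_DO {P : DK} (hP : P ∈ DO) : ∀ f ∈ lat 0, act P f ∈ lat 0 := by
  induction hP using Algebra.adjoin_induction with
  | mem P h =>
    rcases h with ⟨a, ha, h⟩ | h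
    · intro f hf; rw [h, mulOp_apply, ← zero_add (0 : ℤ)]; exact mul_mem_lat ha hf
    · intro f hf i hi
      rw [h, coeff_ddz]
      -- At `i = -1` the coefficient of `f` need not vanish, but the factor `i + 1` does: this is
      -- why `∂` preserves `O`.
      rcases eq_or_ne (i + 1) 0 with h0 | h0
      · have : (i : ℂ) + 1 = 0 := by exact_mod_cast h0
        rw [this, zero_mul]
      · rw [hf _ (by omega), mul_zero]
  | algebraMap c =>
    intro f hf; rw [AlgHom.commutes, Module.algebraMap_end_apply]
    exact Submodule.smul_mem _ _ hf
  | add P Q _ _ h1 h2 => intro f hf; rw [map_add]; exact add_mem (h1 f hf) (h2 f hf)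
  | mul P Q _ _ h1 h2 => intro f hf; rw [map_mul]; exact h1 _ (h2 f hf)

/-- The Euler operator `z∂` is diagonal on monomials, with eigenvalue `i` on `z^i`. -/
theorem coeff_aeval_euler (p : Polynomial ℂ) (f : K) (i : ℤ) :
    coeff (act (Polynomial.aeval (mulD (zpow 1) * ddzD) p) f) i = p.eval (i : ℂ) * coeff f i := by
  have h1 : ∀ g i, coeff (act (mulD (zpow 1) * ddzD) g) i = i * coeff g i := by
    intro g i
    rw [map_mul, Module.End.mul_apply, act_ddzD, act_mulD, mulOp_apply, coeff_zpow_mul, coeff_ddz]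
    push_cast
    rw [sub_add_cancel, sub_add_cancel]
  induction p using Polynomial.induction_on generalizing f with
  | C c =>
    rw [Polynomial.aeval_C, AlgHom.commutes, Module.algebraMap_end_apply, coeff_smul,
      Polynomial.eval_C]
  | add p q hp hq =>
    rw [map_add, map_add, LinearMap.add_apply, coeff_add, hp, hq, Polynomial.eval_add, add_mul]
  | monomial n c ih =>
    rw [pow_succ, ← mul_assoc, map_mul, map_mul, Module.End.mul_apply, ih, Polynomial.aeval_X, h1,
      Polynomial.eval_mul_X, mul_assoc]

/-- A differential operator which is, up to high order, the projection to a monomial. -/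
theorem exists_monomialProj {a b i : ℤ} (hi : i ∈ Finset.Ico a b) :
    ∃ P : DK, ∀ f ∈ lat a, act P f - coeff f i • zpow i ∈ lat b := by
  -- The Lagrange polynomial with nodes `a, …, b - 1` takes the value `1` at `i` and `0` at the
  -- other nodes; beyond `b` its values are uncontrolled.
  refine ⟨Polynomial.aeval (mulD (zpow 1) * ddzD)
    (Lagrange.basis (Finset.Ico a b) (fun j : ℤ => (j : ℂ)) i), fun f hf j hj => ?_⟩
  rw [coeff_sub, coeff_aeval_euler, coeff_smul, coeff_zpow]
  by_cases h : j = i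
  · subst h
    rw [Lagrange.eval_basis_self (v := fun j : ℤ => (j : ℂ))
      (fun x _ y _ h => Int.cast_injective h) hi]
    simp
  · by_cases ha : a ≤ j
    · rw [Lagrange.eval_basis_of_ne (v := fun j : ℤ => (j : ℂ)) (Ne.symm h) (by simp [ha, hj])]
      simp [h]
    · rw [hf j (by omega)]; simp [h]

section

variable {R : Type} [CommRing R] [Algebra ℂ R] {n : ℕ}

/-! ### Laurent series over `R` -/

variable (R) in
/-- `R ⊗ z^a O`. -/
def latB (a : ℤ) : Submodule R (KR R) := (lat a).baseChange R

theorem mem_latR {k : ℤ} {x : Fin n → KR R} : x ∈ latR R n k ↔ ∀ i, x i ∈ latB R k := by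
  simp [latR, latB, Submodule.mem_pi]

variable (R) in
/-- The function `z^k` in `R ⊗ K`. -/
def zK (k : ℤ) : KR R := 1 ⊗ₜ zpow k

variable (R) in
/-- The `i`-th coefficient on `R ⊗ K`. -/
def coeffR (i : ℤ) : KR R →ₗ[R] R :=
  (TensorProduct.AlgebraTensorModule.rid ℂ R R).toLinearMap ∘ₗ (coeffL i).baseChange R

theorem coeffR_tmul (i : ℤ) (r : R) (f : K) : coeffR R i (r ⊗ₜ f) = coeff f i • r := rfl

theorem latB_induction {a : ℤ} {p : (x : KR R) → x ∈ latB R a → Prop}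
    (tmul : ∀ f (hf : f ∈ lat a), p (1 ⊗ₜ f) (Submodule.tmul_mem_baseChange_of_mem 1 hf))
    (add : ∀ x y hx hy, p x hx → p y hy → p (x + y) (add_mem hx hy))
    (smul : ∀ (r : R) x hx, p x hx → p (r • x) (Submodule.smul_mem _ r hx)) {x : KR R}
    (hx : x ∈ latB R a) : p x hx := by
  have hx' := hx
  rw [latB, Submodule.baseChange_eq_span] at hx'
  have : ∃ h : x ∈ latB R a, p x h := by
    induction hx' using Submodule.span_induction with
    | mem x h => obtain ⟨f, hf, rfl⟩ := h; exact ⟨_, tmul f hf⟩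
    | zero => exact ⟨zero_mem _, by simpa using tmul 0 (zero_mem _)⟩
    | add x y h h' h1 h2 =>
      obtain ⟨hx, h1⟩ := h1 (by rwa [latB, Submodule.baseChange_eq_span])
      obtain ⟨hy, h2⟩ := h2 (by rwa [latB, Submodule.baseChange_eq_span])
      exact ⟨_, add x y hx hy h1 h2⟩
    | smul r x h h1 =>
      obtain ⟨hx, h1⟩ := h1 (by rwa [latB, Submodule.baseChange_eq_span])
      exact ⟨_, smul r x hx h1⟩
  exact this.2

theorem tmul_mem_latB {a : ℤ} (r : R) {f : K} (hf : f ∈ lat a) : r ⊗ₜ f ∈ latB R a :=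
  Submodule.tmul_mem_baseChange_of_mem r hf

theorem latB_anti {a b : ℤ} (h : a ≤ b) : latB R b ≤ latB R a := fun x hx => by
  induction hx using latB_induction with
  | tmul f hf => exact tmul_mem_latB 1 (lat_anti h hf)
  | add x y _ _ h h' => exact add_mem h h'
  | smul r x _ h => exact Submodule.smul_mem _ r h

theorem mul_mem_latB {a b : ℤ} {x y : KR R} (hx : x ∈ latB R a) (hy : y ∈ latB R b) :
    x * y ∈ latB R (a + b) := by
  induction hx using latB_induction with
  | tmul f hf =>
    induction hy using latB_induction with
    | tmul g hg =>
      rw [Algebra.TensorProduct.tmul_mul_tmul]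
      exact tmul_mem_latB _ (mul_mem_lat hf hg)
    | add y y' _ _ h h' =>
      rw [mul_add]; exact add_mem h h'
    | smul r y _ h =>
      rw [mul_smul_comm]; exact Submodule.smul_mem _ r h
  | add x x' _ _ h h' =>
    rw [add_mul]; exact add_mem h h'
  | smul r x _ h =>
    rw [smul_mul_assoc]; exact Submodule.smul_mem _ r h

theorem zK_mem_latB {a k : ℤ} (h : a ≤ k) : zK R k ∈ latB R a :=
  tmul_mem_latB _ (zpow_mem_lat h)

theorem zK_mul_zK (a b : ℤ) : zK R a * zK R b = zK R (a + b) := by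
  rw [zK, zK, Algebra.TensorProduct.tmul_mul_tmul, zpow_mul_zpow, one_mul]; rfl

theorem zK_zero : zK R 0 = 1 := rfl

theorem zK_mul_mem_latB {a k : ℤ} {x : KR R} : zK R k * x ∈ latB R a ↔ x ∈ latB R (a - k) := by
  constructor
  · intro h
    have := mul_mem_latB (zK_mem_latB (le_refl (-k))) h
    rwa [← mul_assoc, zK_mul_zK, neg_add_cancel, zK_zero, one_mul,
      show -k + a = a - k by ring] at this
  · intro h
    have := mul_mem_latB (zK_mem_latB (le_refl k)) h
    rwa [add_sub_cancel] at this

theorem exists_mem_latB (x : KR R) : ∃ N : ℕ, x ∈ latB R (-N) := by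
  induction x using TensorProduct.induction_on with
  | zero => exact ⟨0, zero_mem _⟩
  | tmul r f =>
    obtain ⟨N, hN⟩ := exists_mem_lat f
    exact ⟨N, tmul_mem_latB r hN⟩
  | add x y hx hy =>
    obtain ⟨N, hN⟩ := hx
    obtain ⟨M, hM⟩ := hy
    exact ⟨max N M, add_mem (latB_anti (by simp) hN) (latB_anti (by simp) hM)⟩

theorem sub_window_mem_latB {a : ℤ} {x : KR R} (hx : x ∈ latB R a) (b : ℤ) :
    x - ∑ i ∈ Finset.Ico a b, coeffR R i x • zK R i ∈ latB R b := by
  induction hx using latB_induction with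
  | tmul f hf =>
    convert tmul_mem_latB (1 : R) (sub_window_mem_lat hf b) using 1
    rw [TensorProduct.tmul_sub, TensorProduct.tmul_sum]
    congr 1
    refine Finset.sum_congr rfl fun i _ => ?_
    rw [coeffR_tmul, zK, TensorProduct.smul_tmul', TensorProduct.tmul_smul,
      TensorProduct.smul_tmul', smul_eq_mul, mul_one]
  | add x y _ _ h h' =>
    convert add_mem h h' using 1
    simp only [map_add, add_smul, Finset.sum_add_distrib]
    abel
  | smul r x _ h =>
    convert Submodule.smul_mem _ r h using 1
    simp only [map_smul, smul_sub, Finset.smul_sum, smul_smul, smul_eq_mul]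

theorem coeffR_of_mem_latB {a i : ℤ} {x : KR R} (hx : x ∈ latB R a) (hi : i < a) :
    coeffR R i x = 0 := by
  induction hx using latB_induction with
  | tmul f hf =>
    rw [coeffR_tmul, hf i hi, zero_smul]
  | add x y _ _ h h' =>
    rw [map_add, h, h', add_zero]
  | smul r x _ h =>
    rw [map_smul, h, smul_zero]

theorem coeffR_zK (i k : ℤ) : coeffR R i (zK R k) = if i = k then 1 else 0 := by
  rw [zK, coeffR_tmul, coeff_zpow, ite_smul, one_smul, zero_smul]

/-! ### Differential operators over `R` -/

variable (R) in
/-- Multiplication operators over `R`. -/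
def mulR : KR R →ₐ[R] DKR R := Algebra.TensorProduct.map (AlgHom.id R R) mulDHom

variable (R) in
/-- `∂` in `R ⊗ D(K)`. -/
def ddzR : DKR R := 1 ⊗ₜ ddzD

theorem mulR_tmul (r : R) (f : K) : mulR R (r ⊗ₜ f) = r ⊗ₜ mulD f := rfl

theorem mulR_zK (k : ℤ) : mulR R (zK R k) = zpowR R k := rfl

theorem zpowR_mul_zpowR (a b : ℤ) : zpowR R a * zpowR R b = zpowR R (a + b) := by
  rw [← mulR_zK, ← mulR_zK, ← map_mul, zK_mul_zK, mulR_zK]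

theorem zpowR_zero : zpowR R 0 = 1 := by rw [← mulR_zK, zK_zero, map_one]

theorem actK_tmul (r : R) (P : DK) (s : R) (f : K) :
    actK R (r ⊗ₜ P) (s ⊗ₜ f) = (r * s) ⊗ₜ act P f := by
  refine (LinearMap.congr_fun (Algebra.TensorProduct.lift_tmul _ _ _ r P) _).trans ?_
  change (algebraMap R (Module.End R (KR R)) r) (s ⊗ₜ act P f) = _
  rw [Module.algebraMap_end_apply, TensorProduct.smul_tmul', smul_eq_mul]

theorem actK_mulR (x y : KR R) : actK R (mulR R x) y = x * y := by
  induction x using TensorProduct.induction_on with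
  | zero => simp
  | tmul r f =>
    induction y using TensorProduct.induction_on with
    | zero => simp
    | tmul s g => rw [mulR_tmul, actK_tmul, Algebra.TensorProduct.tmul_mul_tmul]; rfl
    | add y y' h h' => rw [map_add, h, h', mul_add]
  | add x x' h h' => rw [map_add, map_add, LinearMap.add_apply, h, h', add_mul]

theorem actK_ddzR_one : actK R (ddzR R) 1 = 0 := by
  rw [Algebra.TensorProduct.one_def, ddzR, actK_tmul, act_ddzD, ddz_one, TensorProduct.tmul_zero]

theorem ddzR_mul_zpowR (k : ℤ) :
    ddzR R * zpowR R k = zpowR R k * ddzR R + (k : ℤ) • zpowR R (k - 1) := by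
  rw [ddzR, zpowR, zpowR, Algebra.TensorProduct.tmul_mul_tmul, Algebra.TensorProduct.tmul_mul_tmul,
    ddzD_mul_mulD, ddz_zpow, ← mulDHom_apply, ← mulDHom_apply, map_smul, TensorProduct.tmul_add,
    Int.cast_smul_eq_zsmul,
    one_mul, ← TensorProduct.tmul_smul]
  rfl

theorem mul_mem_DOR {P Q : DKR R} (hP : P ∈ DOR R) (hQ : Q ∈ DOR R) : P * Q ∈ DOR R :=
  mul_mem hP hQ

theorem tmul_mem_DOR (r : R) {P : DK} (hP : P ∈ DO) : r ⊗ₜ P ∈ DOR R :=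
  ⟨r ⊗ₜ ⟨P, hP⟩, rfl⟩

theorem DOR_induction {p : (x : DKR R) → x ∈ DOR R → Prop}
    (tmul : ∀ (r : R) P (hP : P ∈ DO), p (r ⊗ₜ P) (tmul_mem_DOR r hP))
    (add : ∀ x y hx hy, p x hx → p y hy → p (x + y) (add_mem hx hy))
    {x : DKR R} (hx : x ∈ DOR R) : p x hx := by
  obtain ⟨x, rfl⟩ := hx
  induction x using TensorProduct.induction_on with
  | zero => simpa using tmul 0 0 (zero_mem _)
  | tmul r P => exact tmul r P.1 P.2
  | add x y hx hy => simp only [map_add]; exact add _ _ _ _ hx hy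

theorem mulR_mem_DOR {x : KR R} (hx : x ∈ latB R 0) : mulR R x ∈ DOR R := by
  induction hx using latB_induction with
  | tmul f hf => exact tmul_mem_DOR 1 (mulD_mem_DO hf)
  | add x y _ _ h h' => rw [map_add]; exact add_mem h h'
  | smul r x _ h => rw [map_smul]; exact Subalgebra.smul_mem _ h r

theorem zpowR_mem_DOR {k : ℤ} (h : 0 ≤ k) : zpowR R k ∈ DOR R :=
  mulR_zK (R := R) k ▸ mulR_mem_DOR (zK_mem_latB h)

theorem ddzR_mem_DOR : ddzR R ∈ DOR R := tmul_mem_DOR 1 ddzD_mem_DO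

theorem actK_mem_of_mem_DOR {P : DKR R} (hP : P ∈ DOR R) {x : KR R} (hx : x ∈ latB R 0) :
    actK R P x ∈ latB R 0 := by
  induction hP using DOR_induction with
  | tmul r P hP =>
    induction hx using latB_induction with
    | tmul f hf =>
      rw [actK_tmul]; exact tmul_mem_latB _ (act_mem_lat_of_mem_DO hP f hf)
    | add x y _ _ h h' =>
      rw [map_add]; exact add_mem h h'
    | smul r x _ h =>
      rw [map_smul]; exact Submodule.smul_mem _ r h
  | add P Q _ _ h h' =>
    rw [map_add]; exact add_mem h h'

variable (R) in
/-- Operators of order `< m`. -/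
def ordLT (m : ℕ) : Submodule R (DKR R) :=
  Submodule.span R {P | ∃ x : KR R, ∃ j < m, P = mulR R x * ddzR R ^ j}

theorem ordLT_mono {m m' : ℕ} (h : m ≤ m') : ordLT R m ≤ ordLT R m' :=
  Submodule.span_mono fun _ ⟨x, j, hj, e⟩ => ⟨x, j, hj.trans_le h, e⟩

theorem exists_mem_ordLT (P : DKR R) : ∃ m, P ∈ ordLT R m := by
  induction P using TensorProduct.induction_on with
  | zero => exact ⟨0, zero_mem _⟩
  | tmul r P =>
    have hP : P ∈ Submodule.span ℂ {P : DK | ∃ (a : K) (j : ℕ), P = mulD a * ddzD ^ j} := by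
      rw [span_mulD_mul_ddzD_pow]; trivial
    induction hP using Submodule.span_induction with
    | mem P h =>
      obtain ⟨a, j, rfl⟩ := h
      refine ⟨j + 1, Submodule.subset_span ⟨r ⊗ₜ a, j, Nat.lt_succ_self j, ?_⟩⟩
      rw [mulR_tmul, ddzR, Algebra.TensorProduct.tmul_pow, Algebra.TensorProduct.tmul_mul_tmul,
        one_pow, mul_one]
    | zero => exact ⟨0, by rw [TensorProduct.tmul_zero]; exact zero_mem _⟩
    | add P Q _ _ hP hQ =>
      obtain ⟨a, ha⟩ := hP
      obtain ⟨b, hb⟩ := hQ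
      refine ⟨max a b, ?_⟩
      rw [TensorProduct.tmul_add]
      exact add_mem (ordLT_mono (le_max_left _ _) ha) (ordLT_mono (le_max_right _ _) hb)
    | smul c P _ hP =>
      obtain ⟨a, ha⟩ := hP
      refine ⟨a, ?_⟩
      rw [TensorProduct.tmul_smul, ← algebraMap_smul R c]
      exact Submodule.smul_mem _ _ ha
  | add P Q hP hQ =>
    obtain ⟨a, ha⟩ := hP
    obtain ⟨b, hb⟩ := hQ
    exact ⟨max a b, add_mem (ordLT_mono (le_max_left _ _) ha) (ordLT_mono (le_max_right _ _) hb)⟩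

/-- Right division by `∂`: the terms `x ∂^j` with `j ≥ 1` kill `1`, so the order-zero term is
`P(1)`. This drives the inductions on the order. -/
theorem exists_of_mem_ordLT_succ {m : ℕ} {P : DKR R} (hP : P ∈ ordLT R (m + 1)) :
    ∃ Q ∈ ordLT R m, P = mulR R (actK R P 1) + Q * ddzR R := by
  induction hP using Submodule.span_induction with
  | mem P h =>
    obtain ⟨x, j, hj, rfl⟩ := h
    cases j with
    | zero => exact ⟨0, zero_mem _, by simp [actK_mulR]⟩
    | succ j =>
      refine ⟨mulR R x * ddzR R ^ j, Submodule.subset_span ⟨x, j, by omega, rfl⟩, ?_⟩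
      rw [pow_succ, map_mul, map_mul, Module.End.mul_apply, Module.End.mul_apply, actK_ddzR_one]
      simp [mul_assoc]
  | zero => exact ⟨0, zero_mem _, by simp⟩
  | add P P' _ _ h h' =>
    obtain ⟨Q, hQ, e⟩ := h
    obtain ⟨Q', hQ', e'⟩ := h'
    refine ⟨Q + Q', add_mem hQ hQ', ?_⟩
    rw [map_add, LinearMap.add_apply, map_add, add_mul]
    nth_rewrite 1 [e, e']
    abel
  | smul r P _ h =>
    obtain ⟨Q, hQ, e⟩ := h
    refine ⟨r • Q, Submodule.smul_mem _ _ hQ, ?_⟩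
    rw [map_smul, LinearMap.smul_apply, map_smul, smul_mul_assoc, ← smul_add, ← e]

/-- Every operator is `P(1)` up to a left multiple of `∂`. -/
theorem exists_eq_mulR_add (P : DKR R) : ∃ Q, P = mulR R (actK R P 1) + Q * ddzR R := by
  obtain ⟨m, hm⟩ := exists_mem_ordLT P
  obtain ⟨Q, -, h⟩ := exists_of_mem_ordLT_succ (ordLT_mono (Nat.le_succ m) hm)
  exact ⟨Q, h⟩

theorem exists_actK_ddzR_eq {x : KR R} (hx : x ∈ latB R 0) :
    ∃ y ∈ latB R 0, actK R (ddzR R) y = x := by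
  induction hx using latB_induction with
  | tmul f hf =>
    obtain ⟨g, hg, rfl⟩ := exists_ddz_eq hf
    exact ⟨1 ⊗ₜ g, tmul_mem_latB 1 hg, by rw [ddzR, actK_tmul, one_mul]; rfl⟩
  | add x x' _ _ h h' =>
    obtain ⟨y, hy, rfl⟩ := h
    obtain ⟨y', hy', rfl⟩ := h'
    exact ⟨y + y', add_mem hy hy', map_add _ _ _⟩
  | smul r x _ h =>
    obtain ⟨y, hy, rfl⟩ := h
    exact ⟨r • y, Submodule.smul_mem _ _ hy, map_smul _ _ _⟩

theorem one_mem_latB : (1 : KR R) ∈ latB R 0 := zK_zero (R := R) ▸ zK_mem_latB le_rfl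

/-- `R ⊗ D(O)` consists of the operators preserving `R ⊗ O`. -/
theorem mem_DOR_iff {P : DKR R} : P ∈ DOR R ↔ ∀ x ∈ latB R 0, actK R P x ∈ latB R 0 := by
  refine ⟨fun h x hx => actK_mem_of_mem_DOR h hx, fun h => ?_⟩
  obtain ⟨m, hm⟩ := exists_mem_ordLT P
  induction m generalizing P with
  | zero =>
    have : P = 0 := by simpa [ordLT] using hm
    rw [this]; exact zero_mem _
  | succ m ih =>
    obtain ⟨Q, hQ, e⟩ := exists_of_mem_ordLT_succ hm
    have h1 := h 1 one_mem_latB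
    rw [e]
    refine add_mem (mulR_mem_DOR h1) (mul_mem_DOR (ih (fun x hx => ?_) hQ) ddzR_mem_DOR)
    -- The quotient `Q` also preserves `O`: every `x` is some `∂y` with `y ∈ O`, and `Q(∂y) = P(y) -
    -- P(1) y`.
    obtain ⟨y, hy, rfl⟩ := exists_actK_ddzR_eq hx
    rw [← Module.End.mul_apply, ← map_mul, eq_sub_of_add_eq' e.symm, map_sub, LinearMap.sub_apply,
      actK_mulR]
    refine sub_mem (h y hy) ?_
    have := mul_mem_latB h1 hy
    rwa [add_zero] at this

theorem exists_actK_shift (P : DKR R) :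
    ∃ d : ℕ, ∀ (a : ℤ), ∀ x ∈ latB R a, actK R P x ∈ latB R (a - d) := by
  obtain ⟨m, hm⟩ := exists_mem_ordLT P
  induction m generalizing P with
  | zero =>
    have : P = 0 := by simpa [ordLT] using hm
    exact ⟨0, fun a x _ => by rw [this, map_zero]; exact zero_mem _⟩
  | succ m ih =>
    obtain ⟨Q, hQ, e⟩ := exists_of_mem_ordLT_succ hm
    obtain ⟨d, hd⟩ := ih Q hQ
    obtain ⟨N, hN⟩ := exists_mem_latB (actK R P 1)
    -- `N` bounds the pole of `P(1)`, `d` is the loss due to `Q`, and `∂` costs one more.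
    refine ⟨N + d + 1, fun a x hx => ?_⟩
    rw [e, map_add, map_mul, LinearMap.add_apply, Module.End.mul_apply, actK_mulR]
    refine add_mem (latB_anti (by push_cast; omega) (mul_mem_latB hN hx))
      (latB_anti (b := a - 1 - d) (by push_cast; omega) (hd _ _ ?_))
    induction hx using latB_induction with
    | tmul f hf =>
      rw [ddzR, actK_tmul]; exact tmul_mem_latB _ (ddz_mem_lat hf)
    | add x y _ _ h h' =>
      rw [map_add]; exact add_mem h h'
    | smul r x _ h =>
      rw [map_smul]; exact Submodule.smul_mem _ r h

theorem exists_monomialProjR {a b i : ℤ} (hi : i ∈ Finset.Ico a b) :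
    ∃ P : DK, ∀ (S : Type) [CommRing S] [Algebra ℂ S], ∀ x ∈ latB S a,
      actK S (1 ⊗ₜ P) x - coeffR S i x • zK S i ∈ latB S b := by
  obtain ⟨P, hP⟩ := exists_monomialProj hi
  refine ⟨P, fun S _ _ x hx => ?_⟩
  induction hx using latB_induction with
  | tmul f hf =>
    convert tmul_mem_latB (1 : S) (hP f hf) using 1
    rw [TensorProduct.tmul_sub, actK_tmul, one_mul, coeffR_tmul, zK, TensorProduct.smul_tmul',
      TensorProduct.tmul_smul, TensorProduct.smul_tmul', smul_eq_mul, mul_one]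
  | add x y _ _ h h' =>
    convert add_mem h h' using 1
    simp only [map_add, add_smul]
    abel
  | smul r x _ h =>
    convert Submodule.smul_mem _ r h using 1
    simp only [map_smul, smul_sub, smul_smul, smul_eq_mul]

end

section

variable {R : Type} [CommRing R] [Algebra ℂ R] {n : ℕ}

/-! ### Columns of operators -/

/-- Value of a column of operators on a function. -/
def vact (v : Fin n → DKR R) (x : KR R) : Fin n → KR R := fun i => actK R (v i) x

theorem vact_add_left (v w : Fin n → DKR R) (x : KR R) : vact (v + w) x = vact v x + vact w x := by
  funext i; simp [vact]

theorem vact_zero_left (x : KR R) : vact (0 : Fin n → DKR R) x = 0 := by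
  funext i; simp [vact]

theorem vact_add (v : Fin n → DKR R) (x y : KR R) : vact v (x + y) = vact v x + vact v y := by
  funext i; simp [vact]

theorem vact_smul (v : Fin n → DKR R) (r : R) (x : KR R) : vact v (r • x) = r • vact v x := by
  funext i; simp [vact]

/-- Right multiplication of a column by an operator. -/
def rmul (v : Fin n → DKR R) (P : DKR R) : Fin n → DKR R := fun i => v i * P

theorem rmul_mul (v : Fin n → DKR R) (P Q : DKR R) : rmul v (P * Q) = rmul (rmul v P) Q := by
  funext i; simp [rmul, mul_assoc]

theorem rmul_add (v : Fin n → DKR R) (P Q : DKR R) : rmul v (P + Q) = rmul v P + rmul v Q := by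
  funext i; simp [rmul, mul_add]

theorem sub_rmul (v w : Fin n → DKR R) (P : DKR R) : rmul (v - w) P = rmul v P - rmul w P := by
  funext i; simp [rmul, sub_mul]

theorem rmul_one (v : Fin n → DKR R) : rmul v 1 = v := by
  funext i; simp [rmul]

theorem vact_rmul (v : Fin n → DKR R) (P : DKR R) (x : KR R) :
    vact (rmul v P) x = vact v (actK R P x) := by
  funext i; simp [rmul, vact]

theorem rmul_mem {M : DSub R n} {v : Fin n → DKR R} (hv : v ∈ M) {P : DKR R} (hP : P ∈ DOR R) :
    rmul v P ∈ M :=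
  M.smul_mem (⟨MulOpposite.op P, hP⟩ : (DOR R).op) hv

theorem smul_mem_DSub {M : DSub R n} {v : Fin n → DKR R} (hv : v ∈ M) (r : R) : r • v ∈ M :=
  (M.restrictScalars R).smul_mem r hv

theorem span_induction_DSub {s : Set (Fin n → DKR R)} {p : (Fin n → DKR R) → Prop}
    (mem : ∀ v ∈ s, p v) (zero : p 0) (add : ∀ v w, p v → p w → p (v + w))
    (rmul : ∀ v, ∀ P ∈ DOR R, p v → p (rmul v P)) {v : Fin n → DKR R}
    (hv : v ∈ Submodule.span (DOR R).op s) : p v := by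
  induction hv using Submodule.span_induction with
  | mem v h => exact mem v h
  | zero => exact zero
  | add v w _ _ h h' => exact add v w h h'
  | smul P v _ h => exact rmul v P.1.unop P.2 h

theorem leftMul_apply (g : Matrix (Fin n) (Fin n) (DKR R)) (v : Fin n → DKR R) :
    leftMul g v = g.mulVec v := rfl

theorem leftMul_mul (g h : Matrix (Fin n) (Fin n) (DKR R)) (v : Fin n → DKR R) :
    leftMul (g * h) v = leftMul g (leftMul h v) :=
  (Matrix.mulVec_mulVec v g h).symm

theorem leftMul_add (g h : Matrix (Fin n) (Fin n) (DKR R)) (v : Fin n → DKR R) :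
    leftMul (g + h) v = leftMul g v + leftMul h v := Matrix.add_mulVec g h v

theorem leftMul_sub (g h : Matrix (Fin n) (Fin n) (DKR R)) (v : Fin n → DKR R) :
    leftMul (g - h) v = leftMul g v - leftMul h v := Matrix.sub_mulVec g h v

theorem leftMul_one (v : Fin n → DKR R) : leftMul 1 v = v := Matrix.one_mulVec v

theorem leftMul_smul (r : R) (g : Matrix (Fin n) (Fin n) (DKR R)) (v : Fin n → DKR R) :
    leftMul (r • g) v = r • leftMul g v := Matrix.smul_mulVec r g v

theorem rmul_leftMul (g : Matrix (Fin n) (Fin n) (DKR R)) (v : Fin n → DKR R) (P : DKR R) :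
    rmul (leftMul g v) P = leftMul g (rmul v P) := by
  funext i
  simp [leftMul_apply, rmul, Matrix.mulVec, dotProduct, Finset.sum_mul, mul_assoc]

theorem matActK_apply (g : Matrix (Fin n) (Fin n) (DKR R)) (x : Fin n → KR R) (i : Fin n) :
    matActK g x i = ∑ j, actK R (g i j) (x j) := by
  simp [matActK]

theorem vact_leftMul (g : Matrix (Fin n) (Fin n) (DKR R)) (v : Fin n → DKR R) (x : KR R) :
    vact (leftMul g v) x = matActK g (vact v x) := by
  funext i
  rw [matActK_apply, vact, leftMul_apply, Matrix.mulVec, dotProduct, map_sum,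
    LinearMap.sum_apply]
  simp [vact]

theorem matActK_sub (g h : Matrix (Fin n) (Fin n) (DKR R)) (x : Fin n → KR R) :
    matActK (g - h) x = matActK g x - matActK h x := by
  funext i; simp [matActK_apply]

theorem matActK_one (x : Fin n → KR R) : matActK (1 : Matrix (Fin n) (Fin n) (DKR R)) x = x := by
  funext i
  rw [matActK_apply, Finset.sum_eq_single i]
  · simp
  · intro j _ hj; rw [Matrix.one_apply_ne hj.symm]; simp
  · simp

theorem matActK_mul (g h : Matrix (Fin n) (Fin n) (DKR R)) (x : Fin n → KR R) :
    matActK (g * h) x = matActK g (matActK h x) := by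
  funext i
  simp only [matActK_apply, Matrix.mul_apply, map_sum, LinearMap.sum_apply, map_mul,
    Module.End.mul_apply]
  exact Finset.sum_comm

theorem map_leftMul_mul (g h : Matrix (Fin n) (Fin n) (DKR R)) (M : DSub R n) :
    M.map (leftMul (g * h)) = (M.map (leftMul h)).map (leftMul g) := by
  rw [← Submodule.map_comp]
  congr 1
  exact LinearMap.ext fun v => leftMul_mul g h v

theorem map_leftMul_one (M : DSub R n) : M.map (leftMul 1) = M := by
  have : leftMul (1 : Matrix (Fin n) (Fin n) (DKR R)) = LinearMap.id :=
    LinearMap.ext leftMul_one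
  rw [this, Submodule.map_id]

/-! ### The standard lattices -/

variable (R n) in
/-- The submodule `z^b D^n`. -/
def zD (b : ℤ) : DSub R n where
  carrier := {v | ∀ i, zpowR R (-b) * v i ∈ DOR R}
  zero_mem' i := by rw [Pi.zero_apply, mul_zero]; exact zero_mem _
  add_mem' hv hw i := by rw [Pi.add_apply, mul_add]; exact add_mem (hv i) (hw i)
  smul_mem' P v hv i := by
    change zpowR R (-b) * (v i * P.1.unop) ∈ DOR R
    rw [← mul_assoc]
    exact mul_mem (hv i) P.2

theorem mem_zD {b : ℤ} {v : Fin n → DKR R} : v ∈ zD R n b ↔ ∀ i, zpowR R (-b) * v i ∈ DOR R :=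
  Iff.rfl

/-- The dictionary between lattices of operators and lattices of functions, a form of `mem_DOR_iff`;
estimates on `D^n` are thereby reduced to estimates on `O^n`. -/
theorem mem_zD_iff {b : ℤ} {v : Fin n → DKR R} :
    v ∈ zD R n b ↔ ∀ x ∈ latB R 0, vact v x ∈ latR R n b := by
  simp only [mem_zD, mem_DOR_iff, mem_latR, vact, map_mul, Module.End.mul_apply, ← mulR_zK,
    actK_mulR, zK_mul_mem_latB, zero_sub, neg_neg]
  exact ⟨fun h x hx i => h i x hx, fun h i x hx => h x hx i⟩

theorem unitPt_eq_zD : unitPt R n = zD R n 0 := by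
  ext v
  rw [mem_zD, neg_zero, zpowR_zero]
  simp only [one_mul]
  rfl

theorem zD_anti {a b : ℤ} (h : a ≤ b) : zD R n b ≤ zD R n a := fun v hv => by
  rw [mem_zD_iff] at hv ⊢
  exact fun x hx => mem_latR.2 fun i => latB_anti h (mem_latR.1 (hv x hx) i)

theorem latR_anti {a b : ℤ} (h : a ≤ b) : latR R n b ≤ latR R n a := fun x hx => by
  rw [mem_latR] at hx ⊢
  exact fun i => latB_anti h (hx i)

variable (n) in
/-- The scalar matrix `z^k`. -/
def zMat (R : Type) [CommRing R] [Algebra ℂ R] (k : ℤ) : Matrix (Fin n) (Fin n) (DKR R) :=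
  Matrix.diagonal fun _ => zpowR R k

theorem leftMul_zMat (k : ℤ) (v : Fin n → DKR R) (i : Fin n) :
    leftMul (zMat n R k) v i = zpowR R k * v i := by
  rw [leftMul_apply, zMat, Matrix.mulVec_diagonal]

theorem leftMul_zMat_zMat (a b : ℤ) (v : Fin n → DKR R) :
    leftMul (zMat n R a) (leftMul (zMat n R b) v) = leftMul (zMat n R (a + b)) v := by
  funext i
  rw [leftMul_zMat, leftMul_zMat, leftMul_zMat, ← mul_assoc, zpowR_mul_zpowR]

theorem leftMul_zMat_zero (v : Fin n → DKR R) : leftMul (zMat n R 0) v = v := by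
  funext i
  rw [leftMul_zMat, zpowR_zero, one_mul]

theorem leftMul_zMat_mem {a b : ℤ} {v : Fin n → DKR R} (hv : v ∈ zD R n a) :
    leftMul (zMat n R b) v ∈ zD R n (a + b) := fun i => by
  rw [leftMul_zMat, ← mul_assoc, zpowR_mul_zpowR, show -(a + b) + b = -a by ring]
  exact hv i

/-! ### Bounded matrices -/

/-- The matrix maps `z^a D^n` to `z^b D^n`. -/
def Bdd (a b : ℤ) (A : Matrix (Fin n) (Fin n) (DKR R)) : Prop :=
  ∀ v ∈ zD R n a, leftMul A v ∈ zD R n b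

theorem Bdd.add {a b : ℤ} {A B : Matrix (Fin n) (Fin n) (DKR R)} (hA : Bdd a b A)
    (hB : Bdd a b B) : Bdd a b (A + B) := fun v hv => by
  rw [leftMul_add]; exact add_mem (hA v hv) (hB v hv)

theorem Bdd.sub {a b : ℤ} {A B : Matrix (Fin n) (Fin n) (DKR R)} (hA : Bdd a b A)
    (hB : Bdd a b B) : Bdd a b (A - B) := fun v hv => by
  rw [leftMul_sub]; exact sub_mem (hA v hv) (hB v hv)

theorem Bdd.mul {a b c : ℤ} {A B : Matrix (Fin n) (Fin n) (DKR R)} (hA : Bdd b c A)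
    (hB : Bdd a b B) : Bdd a c (A * B) := fun v hv => by
  rw [leftMul_mul]; exact hA _ (hB v hv)

theorem Bdd.one (a : ℤ) : Bdd a a (1 : Matrix (Fin n) (Fin n) (DKR R)) := fun v hv => by
  rwa [leftMul_one]

theorem Bdd.of_matActK {a b : ℤ} {A : Matrix (Fin n) (Fin n) (DKR R)}
    (h : ∀ x ∈ latR R n a, matActK A x ∈ latR R n b) : Bdd a b A := fun v hv => by
  rw [mem_zD_iff] at hv ⊢
  intro x hx
  rw [vact_leftMul]
  exact h _ (hv x hx)

/-! ### The de Rham functor -/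

theorem mem_deRham_of_mem {M : DSub R n} {m : Fin n → DKR R} (hm : m ∈ M) {x : KR R}
    (hx : x ∈ latB R 0) : vact m x ∈ deRham M := by
  induction hx using latB_induction with
  | tmul f hf => exact Submodule.subset_span ⟨m, hm, f, hf, rfl⟩
  | add x y _ _ h h' => rw [vact_add]; exact add_mem h h'
  | smul r x _ h => rw [vact_smul]; exact Submodule.smul_mem _ r h

/-- Since `m(f) = (m f)(1)` and `m f ∈ M` for `f ∈ O`, values at `1` suffice, and they already form
a submodule. -/
theorem exists_of_mem_deRham {M : DSub R n} {x : Fin n → KR R} (hx : x ∈ deRham M) :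
    ∃ m ∈ M, vact m 1 = x := by
  induction hx using Submodule.span_induction with
  | mem x h =>
    obtain ⟨m, hm, f, hf, rfl⟩ := h
    refine ⟨rmul m (mulR R (1 ⊗ₜ f)), rmul_mem hm (mulR_mem_DOR (tmul_mem_latB 1 hf)), ?_⟩
    rw [vact_rmul, actK_mulR, mul_one]
    rfl
  | zero => exact ⟨0, zero_mem _, vact_zero_left 1⟩
  | add x y _ _ h h' =>
    obtain ⟨m, hm, rfl⟩ := h
    obtain ⟨m', hm', rfl⟩ := h'
    exact ⟨m + m', add_mem hm hm', vact_add_left m m' 1⟩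
  | smul r x _ h =>
    obtain ⟨m, hm, rfl⟩ := h
    exact ⟨r • m, smul_mem_DSub hm r, by funext i; simp [vact]⟩

theorem mem_deRham_iff {M : DSub R n} {x : Fin n → KR R} :
    x ∈ deRham M ↔ ∃ m ∈ M, vact m 1 = x :=
  ⟨exists_of_mem_deRham, fun ⟨_, hm, h⟩ => h ▸ mem_deRham_of_mem hm one_mem_latB⟩

theorem deRham_mono {M N : DSub R n} (h : M ≤ N) : deRham M ≤ deRham N := fun x hx => by
  rw [mem_deRham_iff] at hx ⊢
  obtain ⟨m, hm, e⟩ := hx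
  exact ⟨m, h hm, e⟩

theorem deRham_map (g : Matrix (Fin n) (Fin n) (DKR R)) (M : DSub R n) :
    deRham (M.map (leftMul g)) = (deRham M).map (matActK g) := by
  ext x
  simp only [mem_deRham_iff, Submodule.mem_map]
  constructor
  · rintro ⟨_, ⟨m, hm, rfl⟩, rfl⟩
    exact ⟨_, ⟨m, hm, rfl⟩, (vact_leftMul g m 1).symm⟩
  · rintro ⟨_, ⟨m, hm, rfl⟩, rfl⟩
    exact ⟨_, ⟨m, hm, rfl⟩, vact_leftMul g m 1⟩

theorem deRham_zD (b : ℤ) : deRham (zD R n b) = latR R n b := by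
  refine le_antisymm (fun x hx => ?_) fun x hx => ?_
  · obtain ⟨m, hm, rfl⟩ := exists_of_mem_deRham hx
    exact mem_zD_iff.1 hm 1 one_mem_latB
  · refine mem_deRham_iff.2 ⟨fun i => mulR R (x i), mem_zD_iff.2 fun y hy => ?_, ?_⟩
    · refine mem_latR.2 fun i => ?_
      have := mul_mem_latB (mem_latR.1 hx i) hy
      rw [add_zero] at this
      rwa [vact, actK_mulR]
    · funext i; rw [vact, actK_mulR, mul_one]

/-! ### Lattices cut out by approximate idempotents -/

/-- A matrix of operators inducing an idempotent on `z^{-k} D^n / z^k D^n`. -/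
structure IsIdem (k : ℕ) (E : Matrix (Fin n) (Fin n) (DKR R)) : Prop where
  neg : Bdd (-k) (-k) E
  pos : Bdd k k E
  idem : Bdd (-k) k (E * E - E)

/-- The right submodule `E z^{-k} D^n + z^k D^n`. -/
def idemD (k : ℕ) (E : Matrix (Fin n) (Fin n) (DKR R)) : DSub R n :=
  zD R n (-k) ⊓ (zD R n k).comap (leftMul (1 - E))

/-- The subspace `E z^{-k} O^n + z^k O^n`. -/
def idemK (k : ℕ) (E : Matrix (Fin n) (Fin n) (DKR R)) : Submodule R (Fin n → KR R) :=
  latR R n (-k) ⊓ (latR R n k).comap (matActK (1 - E))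

theorem mem_idemD {k : ℕ} {E : Matrix (Fin n) (Fin n) (DKR R)} {v : Fin n → DKR R} :
    v ∈ idemD k E ↔ v ∈ zD R n (-k) ∧ leftMul (1 - E) v ∈ zD R n k := Iff.rfl

theorem mem_idemK {k : ℕ} {E : Matrix (Fin n) (Fin n) (DKR R)} {x : Fin n → KR R} :
    x ∈ idemK k E ↔ x ∈ latR R n (-k) ∧ matActK (1 - E) x ∈ latR R n k := Iff.rfl

section

variable {k : ℕ} {E : Matrix (Fin n) (Fin n) (DKR R)} (hE : IsIdem k E)
include hE

theorem IsIdem.zD_le : zD R n k ≤ idemD k E := fun v hv =>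
  ⟨zD_anti (by omega) hv, (Bdd.one _).sub hE.pos v hv⟩

/-- Because `(1 - E) E = -(E² - E)` is small. With `zD_le` and `idemD_eq_add` this describes `idemD`
as a sum. The defining intersection is convenient for testing membership, the sum for computing
images and base change. -/
theorem IsIdem.map_le : (zD R n (-k)).map (leftMul E) ≤ idemD k E := by
  rintro _ ⟨v, hv, rfl⟩
  refine ⟨hE.neg v hv, ?_⟩
  change leftMul (1 - E) (leftMul E v) ∈ zD R n k
  have := (zD R n k).neg_mem (hE.idem v hv)
  rw [← leftMul_mul, sub_mul, one_mul, leftMul_sub]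
  rwa [leftMul_sub, neg_sub] at this

omit hE in
theorem idemD_eq_add (v : Fin n → DKR R) : v = leftMul E v + leftMul (1 - E) v := by
  rw [leftMul_sub, leftMul_one, add_sub_cancel]

theorem IsIdem.deRham_idemD : deRham (idemD k E) = idemK k E := by
  refine le_antisymm (fun x hx => ?_) fun x hx => ?_
  · obtain ⟨m, hm, rfl⟩ := exists_of_mem_deRham hx
    refine ⟨mem_zD_iff.1 hm.1 1 one_mem_latB, ?_⟩
    have := mem_zD_iff.1 hm.2 1 one_mem_latB
    rwa [vact_leftMul] at this
  · have hsum : x = matActK E x + matActK (1 - E) x := by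
      rw [matActK_sub, matActK_one, add_sub_cancel]
    rw [hsum]
    refine add_mem (deRham_mono hE.map_le ?_) (deRham_mono hE.zD_le ?_)
    · rw [deRham_map, deRham_zD]
      exact Submodule.mem_map_of_mem hx.1
    · rw [deRham_zD]
      exact hx.2

end

/-- An operator which is an approximate idempotent with respect to a pair of complemented
subspaces gives a projection to the subspace it cuts out. -/
theorem exists_proj_of_approx_idem {R : Type*} [CommRing R] {V : Type*} [AddCommGroup V]
    [Module R V] {A B X : Submodule R V}
    {E π ρ : V →ₗ[R] V} (hπ : ∀ v, π v ∈ A) (hπ' : ∀ v ∈ A, π v = v) (hρ : ∀ v, ρ v ∈ B)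
    (hρ' : ∀ v ∈ B, ρ v = v) (hX : ∀ v, v ∈ X ↔ v ∈ A ∧ v - E v ∈ B) (hBX : B ≤ X)
    (hEX : ∀ v ∈ A, E v ∈ X) : ∃ p : V →ₗ[R] V, (∀ v, p v ∈ X) ∧ ∀ v ∈ X, p v = v := by
  -- On `X` the vector `v - E v` is in `B`, so `ρ` fixes it; hence `ρ v + E v - ρ (E v) = v`.
  let p : V →ₗ[R] V := ρ + (LinearMap.id - ρ) ∘ₗ E ∘ₗ π
  have h : ∀ v, p v = ρ v + (E (π v) - ρ (E (π v))) := fun v => rfl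
  refine ⟨p, fun v => ?_, fun v hv => ?_⟩
  · rw [h]
    exact add_mem (hBX (hρ _)) (sub_mem (hEX _ (hπ v)) (hBX (hρ _)))
  · obtain ⟨h1, h2⟩ := (hX v).1 hv
    have h3 := hρ' _ h2
    rw [map_sub] at h3
    rw [h, hπ' v h1]
    rw [add_sub_left_comm, h3, add_sub_cancel]

theorem flat_of_proj {R : Type*} [CommRing R] {V : Type*} [AddCommGroup V]
    [Module R V] [Module.Flat R V] {X : Submodule R V} {p : V →ₗ[R] V} (h : ∀ v, p v ∈ X)
    (h' : ∀ v ∈ X, p v = v) : Module.Flat R X :=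
  Module.Flat.of_retract X.subtype (p.codRestrict X h)
    (LinearMap.ext fun v => Subtype.ext (h' v v.2))

/-- The map `1 - p` kills `X` and splits the quotient map; flatness and projectivity of quotients
are read off from this. -/
theorem quotient_retract_of_proj {R : Type*} [CommRing R] {V : Type*} [AddCommGroup V]
    [Module R V] {X : Submodule R V} {p : V →ₗ[R] V} (h : ∀ v, p v ∈ X)
    (h' : ∀ v ∈ X, p v = v) : ∃ i : V ⧸ X →ₗ[R] V, X.mkQ ∘ₗ i = LinearMap.id := by
  refine ⟨X.liftQ (LinearMap.id - p) fun v hv => by simp [h' v hv], ?_⟩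
  refine Submodule.linearMap_qext _ (LinearMap.ext fun v => ?_)
  change X.mkQ (v - p v) = X.mkQ v
  rw [map_sub, sub_eq_self]
  exact (Submodule.Quotient.mk_eq_zero X).2 (h v)

/-- Base change of a projection to a complex subspace. -/
theorem exists_proj_baseChange {V : Type*} [AddCommGroup V] [Module ℂ V] (W : Submodule ℂ V) :
    ∃ p : R ⊗[ℂ] V →ₗ[R] R ⊗[ℂ] V, (∀ v, p v ∈ W.baseChange R) ∧
      ∀ v ∈ W.baseChange R, p v = v := by
  obtain ⟨q, hq⟩ := W.exists_isCompl
  let p := W.subtype ∘ₗ W.projectionOnto q hq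
  have hp : ∀ v ∈ W, p v = v := fun v hv => by
    exact congrArg Subtype.val (Submodule.projectionOnto_apply_left hq ⟨v, hv⟩)
  refine ⟨p.baseChange R, fun v => ?_, fun v hv => ?_⟩
  · induction v using TensorProduct.induction_on with
    | zero => rw [map_zero]; exact zero_mem _
    | tmul r v =>
      rw [LinearMap.baseChange_tmul]
      exact Submodule.tmul_mem_baseChange_of_mem r (Subtype.prop _)
    | add v w h h' => rw [map_add]; exact add_mem h h'
  · rw [Submodule.baseChange_eq_span] at hv
    induction hv using Submodule.span_induction with
    | mem v h => obtain ⟨w, hw, rfl⟩ := h; simp [hp w hw]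
    | zero => simp
    | add v w _ _ h h' => rw [map_add, h, h']
    | smul r v _ h => rw [map_smul, h]

theorem mem_DOR_iff_baseChange {P : DKR R} :
    P ∈ DOR R ↔ P ∈ (Subalgebra.toSubmodule DO).baseChange R := by
  constructor
  · intro h
    induction h using DOR_induction with
    | tmul r P hP => exact Submodule.tmul_mem_baseChange_of_mem r hP
    | add x y _ _ h h' => exact add_mem h h'
  · intro h
    rw [Submodule.baseChange_eq_span] at h
    induction h using Submodule.span_induction with
    | mem v h => obtain ⟨w, hw, rfl⟩ := h; exact tmul_mem_DOR 1 hw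
    | zero => exact zero_mem _
    | add v w _ _ h h' => exact add_mem h h'
    | smul r v _ h => exact Subalgebra.smul_mem _ h r

theorem exists_proj_latR (a : ℤ) : ∃ p : (Fin n → KR R) →ₗ[R] (Fin n → KR R),
    (∀ v, p v ∈ latR R n a) ∧ ∀ v ∈ latR R n a, p v = v := by
  obtain ⟨p, h, h'⟩ := exists_proj_baseChange (R := R) (lat a)
  refine ⟨LinearMap.pi fun i => p ∘ₗ LinearMap.proj i, fun v => mem_latR.2 fun i => h _,
    fun v hv => funext fun i => h' _ (mem_latR.1 hv i)⟩

theorem exists_proj_zD (a : ℤ) : ∃ p : (Fin n → DKR R) →ₗ[R] (Fin n → DKR R),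
    (∀ v, p v ∈ zD R n a) ∧ ∀ v ∈ zD R n a, p v = v := by
  obtain ⟨p, h, h'⟩ := exists_proj_baseChange (R := R) (Subalgebra.toSubmodule DO)
  refine ⟨LinearMap.pi fun i => LinearMap.mulLeft R (zpowR R a) ∘ₗ p ∘ₗ
    LinearMap.mulLeft R (zpowR R (-a)) ∘ₗ LinearMap.proj i, fun v => ?_, fun v hv => ?_⟩
  · intro i
    change zpowR R (-a) * (zpowR R a * p (zpowR R (-a) * v i)) ∈ DOR R
    rw [← mul_assoc, zpowR_mul_zpowR, neg_add_cancel, zpowR_zero, one_mul, mem_DOR_iff_baseChange]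
    exact h _
  · funext i
    change zpowR R a * p (zpowR R (-a) * v i) = v i
    rw [h' _ (mem_DOR_iff_baseChange.1 (hv i)), ← mul_assoc, zpowR_mul_zpowR, add_neg_cancel,
      zpowR_zero, one_mul]

instance : Module.Free R (DKR R) := inferInstanceAs (Module.Free R (R ⊗[ℂ] DK))

instance : Module.Free R (KR R) := inferInstanceAs (Module.Free R (R ⊗[ℂ] K))

theorem IsIdem.isSato {k : ℕ} {E : Matrix (Fin n) (Fin n) (DKR R)} (hE : IsIdem k E) :
    IsSato (idemK k E) := by
  have hpos : latR R n k ≤ idemK k E := by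
    rw [← hE.deRham_idemD, ← deRham_zD]; exact deRham_mono hE.zD_le
  refine ⟨⟨k, hpos, inf_le_left⟩, ?_⟩
  obtain ⟨π, hπ, hπ'⟩ := exists_proj_latR (R := R) (n := n) (-k)
  obtain ⟨ρ, hρ, hρ'⟩ := exists_proj_latR (R := R) (n := n) k
  obtain ⟨p, hp, hp'⟩ := exists_proj_of_approx_idem (X := idemK k E) (E := matActK E) hπ hπ' hρ hρ'
    (fun v => by rw [mem_idemK, matActK_sub, matActK_one]) hpos (fun v hv => by
      rw [← hE.deRham_idemD]
      refine deRham_mono hE.map_le ?_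
      rw [deRham_map, deRham_zD]
      exact Submodule.mem_map_of_mem hv)
  obtain ⟨i, hi⟩ := quotient_retract_of_proj hp hp'
  exact Module.Projective.of_split i _ hi

variable (R n) in
/-- `D^n` is free. -/
def unitPtEquiv : unitPt R n ≃ₗ[(DOR R).op] (Fin n → (DOR R).op) where
  toFun v i := ⟨MulOpposite.op (v.1 i), v.2 i⟩
  invFun w := ⟨fun i => (w i).1.unop, fun i => (w i).2⟩
  left_inv _ := rfl
  right_inv _ := rfl
  map_add' _ _ := rfl
  map_smul' _ _ := rfl

instance : Module.Projective (DOR R).op (unitPt R n) :=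
  Module.Projective.of_equiv (unitPtEquiv R n).symm

instance : Module.Finite (DOR R).op (unitPt R n) :=
  Module.Finite.equiv (unitPtEquiv R n).symm

/-- Over `R`, the approximate idempotent yields a projection onto the lattice, giving both flatness
statements. Over `D`, the lattice is a retract of `D^n × D^n`, hence finitely generated projective
and so finitely presented. -/
theorem IsIdem.isGrD {k : ℕ} {E : Matrix (Fin n) (Fin n) (DKR R)} (hE : IsIdem k E) :
    IsGrD (idemD k E) := by
  obtain ⟨π, hπ, hπ'⟩ := exists_proj_zD (R := R) (n := n) (-k)
  obtain ⟨ρ, hρ, hρ'⟩ := exists_proj_zD (R := R) (n := n) k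
  obtain ⟨p, hp, hp'⟩ := exists_proj_of_approx_idem (X := (idemD k E).restrictScalars R)
    (A := (zD R n (-k)).restrictScalars R) (B := (zD R n k).restrictScalars R)
    (E := (leftMul E).restrictScalars R) hπ hπ' hρ hρ'
    (fun v => by
      simp only [Submodule.restrictScalars_mem, mem_idemD, leftMul_sub, leftMul_one]
      rfl) hE.zD_le (fun v hv => hE.map_le ⟨v, hv, rfl⟩)
  refine ⟨flat_of_proj hp hp', ?_, fun v => ?_, ?_⟩
  · have hneg : ∀ v ∈ zD R n (-k), leftMul (zMat n R k) v ∈ unitPt R n := fun v hv => by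
      rw [unitPt_eq_zD]
      convert leftMul_zMat_mem (b := k) hv using 2
      ring
    have hpos : ∀ v ∈ zD R n k, leftMul (zMat n R (-k)) v ∈ unitPt R n := fun v hv => by
      rw [unitPt_eq_zD]
      convert leftMul_zMat_mem (b := -k) hv using 2
      ring
    have hneg' : ∀ v ∈ unitPt R n, leftMul (zMat n R (-k)) v ∈ zD R n (-k) := fun v hv => by
      rw [unitPt_eq_zD] at hv
      convert leftMul_zMat_mem (b := -k) hv using 2
      ring
    have hpos' : ∀ v ∈ unitPt R n, leftMul (zMat n R k) v ∈ zD R n k := fun v hv => by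
      rw [unitPt_eq_zD] at hv
      convert leftMul_zMat_mem (b := k) hv using 2
      ring
    -- The retraction comes from `v = E v + (1 - E) v`, with `z^{±k}` identifying `z^{∓k} D^n` with
    -- `D^n`.
    let s : idemD k E →ₗ[(DOR R).op] unitPt R n × unitPt R n :=
      ((leftMul (zMat n R k)).restrict (p := idemD k E) fun v hv => hneg v hv.1).prod
        ((leftMul (zMat n R (-k)) ∘ₗ leftMul (1 - E)).restrict (p := idemD k E)
          fun v hv => hpos _ hv.2)
    let t : unitPt R n × unitPt R n →ₗ[(DOR R).op] idemD k E :=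
      ((leftMul E ∘ₗ leftMul (zMat n R (-k))).restrict (p := unitPt R n) (q := idemD k E)
        fun v hv => hE.map_le ⟨_, hneg' v hv, rfl⟩).coprod
      ((leftMul (zMat n R k)).restrict (p := unitPt R n) (q := idemD k E)
        fun v hv => hE.zD_le (hpos' v hv))
    have hts : t ∘ₗ s = LinearMap.id := by
      refine LinearMap.ext fun v => Subtype.ext ?_
      change leftMul E (leftMul (zMat n R (-k)) (leftMul (zMat n R k) v.1)) +
        leftMul (zMat n R k) (leftMul (zMat n R (-k)) (leftMul (1 - E) v.1)) = v.1
      rw [leftMul_zMat_zMat, leftMul_zMat_zMat, neg_add_cancel, add_neg_cancel,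
        leftMul_zMat_zero, leftMul_zMat_zero, ← idemD_eq_add]
    have : Module.Projective (DOR R).op (idemD k E) := Module.Projective.of_split s t hts
    have : Module.Finite (DOR R).op (idemD k E) :=
      Module.Finite.of_surjective t fun v => ⟨s v, LinearMap.congr_fun hts v⟩
    exact Module.finitePresentation_of_projective (DOR R).op (idemD k E)
  · have : ∀ i, ∃ d : ℕ, ∀ (a : ℤ), ∀ x ∈ latB R a, actK R (v i) x ∈ latB R (a - d) :=
      fun i => exists_actK_shift (v i)
    choose d hd using this
    -- The entry `v i` lowers orders by at most `d i`; the sum serves as a common bound, and `k` is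
    -- left over.
    refine ⟨k + ∑ i, d i, hE.zD_le (mem_zD_iff.2 fun x hx => mem_latR.2 fun i => ?_)⟩
    have hle : d i ≤ ∑ i, d i := Finset.single_le_sum (fun _ _ => Nat.zero_le _) (Finset.mem_univ i)
    rw [vact, map_mul, Module.End.mul_apply, ← mulR_zK, actK_mulR]
    refine latB_anti ?_ (hd i _ _ (mul_mem_latB (zK_mem_latB le_rfl) hx))
    push_cast
    have : (d i : ℤ) ≤ ∑ i, (d i : ℤ) := by exact_mod_cast hle
    omega
  · obtain ⟨i, hi⟩ := quotient_retract_of_proj hp hp'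
    exact Module.Flat.of_retract i _ hi

end

section

variable {R : Type} [CommRing R] [Algebra ℂ R] {n : ℕ}

/-! ### A submodule is determined by its de Rham image -/

/-- From `(∂ z) z^a = z^{a+1} ∂ + (a + 1) z^a`, having `t z^{a+1}` and `t ∂ z` in `M` gives `(a + 1)
t z^a ∈ M`. As `a + 1` is invertible, the exponent can be lowered to zero. -/
theorem mem_of_rmul_euler {M : DSub R n} {t : Fin n → DKR R} (a : ℕ)
    (h : rmul t (zpowR R a) ∈ M) (h' : rmul t (ddzR R * zpowR R 1) ∈ M) : t ∈ M := by
  induction a with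
  | zero => rwa [Nat.cast_zero, zpowR_zero, rmul_one] at h
  | succ a ih =>
    refine ih ?_
    have e : ddzR R * zpowR R 1 * zpowR R a =
        zpowR R (a + 1 : ℕ) * ddzR R + ((a : ℂ) + 1) • zpowR R a := by
      rw [mul_assoc, zpowR_mul_zpowR, ddzR_mul_zpowR, add_sub_cancel_left, add_comm (1 : ℤ) a,
        ← Int.cast_smul_eq_zsmul ℂ]
      push_cast
      rfl
    have h1 := rmul_mem h' (zpowR_mem_DOR (Int.natCast_nonneg a))
    rw [← rmul_mul, e, rmul_add, rmul_mul] at h1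
    have h2 := (Submodule.add_mem_iff_right _ (rmul_mem h ddzR_mem_DOR)).1 h1
    have hne : (a : ℂ) + 1 ≠ 0 := by exact_mod_cast Nat.succ_ne_zero a
    have h3 := smul_mem_DSub h2 (algebraMap ℂ R ((a : ℂ) + 1)⁻¹)
    convert h3 using 1
    funext i
    simp only [rmul, Pi.smul_apply, algebraMap_smul, mul_smul_comm, smul_smul,
      inv_mul_cancel₀ hne, one_smul]

/-- A column of operators mapping `O` to the de Rham image of `M` belongs to `M`. -/
theorem mem_of_vact_mem_deRham {M : DSub R n}
    (hM : ∀ v : Fin n → DKR R, ∃ N : ℕ, (fun i => v i * zpowR R N) ∈ M) {v : Fin n → DKR R}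
    (hv : ∀ x ∈ latB R 0, vact v x ∈ deRham M) : v ∈ M := by
  obtain ⟨N, hN⟩ := hM v
  change rmul v (zpowR R N) ∈ M at hN
  induction N generalizing v with
  | zero => rwa [Nat.cast_zero, zpowR_zero, rmul_one] at hN
  | succ N ih =>
    -- The column `v z` also maps `O` into `h(M)` and needs one power of `z` less, so induction
    -- applies.
    have h1 : rmul v (zpowR R 1) ∈ M := by
      refine ih (fun x hx => ?_) ?_
      · rw [vact_rmul, ← mulR_zK, actK_mulR]
        refine hv _ (zK_mul_mem_latB.2 (latB_anti (by norm_num) hx))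
      · rwa [← rmul_mul, zpowR_mul_zpowR, add_comm, ← Nat.cast_succ]
    -- Choose `m ∈ M` with `m(1) = v(1)`. Then `v - m` kills `1`, so it equals `t ∂`; moreover `t ∂
    -- z = v z - m z ∈ M`, and the Euler argument puts `t` in `M`.
    obtain ⟨m, hm, e⟩ := exists_of_mem_deRham (hv 1 one_mem_latB)
    choose t ht using fun i => exists_eq_mulR_add ((v - m) i)
    have hsub : v - m = rmul t (ddzR R) := by
      funext i
      have h0 : actK R ((v - m) i) 1 = 0 := by
        rw [Pi.sub_apply, map_sub, LinearMap.sub_apply, sub_eq_zero]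
        exact congrFun e.symm i
      rw [ht i, h0, map_zero, zero_add]
      rfl
    obtain ⟨a, ha⟩ := hM t
    have htM : t ∈ M := by
      refine mem_of_rmul_euler a ha ?_
      rw [rmul_mul, ← hsub, sub_rmul]
      exact sub_mem h1 (rmul_mem hm (zpowR_mem_DOR zero_le_one))
    have := add_mem (rmul_mem htM ddzR_mem_DOR) hm
    rwa [← hsub, sub_add_cancel] at this

/-! ### Windows -/

/-- Monomials `z^i e_b` with `-k ≤ i < k`. -/
abbrev Window (n k : ℕ) : Type := Fin n × ↥(Finset.Ico (-k : ℤ) k)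

variable (R n) in
/-- Laurent polynomials with exponents in the window. -/
def winEmb (k : ℕ) : (Window n k → R) →ₗ[R] (Fin n → KR R) where
  toFun c b := ∑ i : ↥(Finset.Ico (-k : ℤ) k), c (b, i) • zK R i
  map_add' c d := by funext b; simp [add_smul, Finset.sum_add_distrib]
  map_smul' r c := by funext b; simp [mul_smul, Finset.smul_sum]

variable (R n) in
/-- The coefficients in the window. -/
def winProj (k : ℕ) : (Fin n → KR R) →ₗ[R] (Window n k → R) :=
  LinearMap.pi fun w => coeffR R w.2 ∘ₗ LinearMap.proj w.1

theorem winProj_apply (k : ℕ) (x : Fin n → KR R) (w : Window n k) :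
    winProj R n k x w = coeffR R w.2 (x w.1) := rfl

theorem winProj_winEmb (k : ℕ) (c : Window n k → R) : winProj R n k (winEmb R n k c) = c := by
  funext ⟨b, i⟩
  simp only [winProj_apply, winEmb, LinearMap.coe_mk, AddHom.coe_mk, map_sum, map_smul,
    coeffR_zK, smul_eq_mul, mul_ite, mul_one, mul_zero]
  rw [Finset.sum_eq_single i]
  · simp
  · intro j _ hj
    rw [if_neg fun h => hj (Subtype.ext h.symm)]
  · simp

theorem winEmb_mem (k : ℕ) (c : Window n k → R) : winEmb R n k c ∈ latR R n (-k) :=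
  mem_latR.2 fun b => by
    change ∑ i : ↥(Finset.Ico (-k : ℤ) k), c (b, i) • zK R i ∈ _
    exact sum_mem fun i _ => Submodule.smul_mem _ _ (zK_mem_latB (Finset.mem_Ico.1 i.2).1)

theorem sub_winEmb_mem {k : ℕ} {x : Fin n → KR R} (hx : x ∈ latR R n (-k)) :
    x - winEmb R n k (winProj R n k x) ∈ latR R n k := by
  refine mem_latR.2 fun b => ?_
  have := sub_window_mem_latB (mem_latR.1 hx b) (k : ℤ)
  rw [← Finset.sum_coe_sort] at this
  exact this

theorem winProj_eq_zero {k : ℕ} {x : Fin n → KR R} (hx : x ∈ latR R n k) :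
    winProj R n k x = 0 :=
  funext fun w => coeffR_of_mem_latB (mem_latR.1 hx w.1) (Finset.mem_Ico.1 w.2.2).2

theorem mem_iff_winEmb_mem {k : ℕ} {L : Submodule R (Fin n → KR R)} (hL : latR R n k ≤ L)
    {x : Fin n → KR R} (hx : x ∈ latR R n (-k)) :
    x ∈ L ↔ winEmb R n k (winProj R n k x) ∈ L := by
  have h := hL (sub_winEmb_mem hx)
  exact ⟨fun h' => by simpa using sub_mem h' h, fun h' => by simpa using add_mem h h'⟩

/-! ### Existence of approximate idempotents -/

/-- Every matrix over `R` on the window is induced by differential operators. -/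
theorem exists_matActK_window (k : ℕ) (u : Window n k → (Fin n → KR R))
    (hu : ∀ w, u w ∈ latR R n (-k)) : ∃ E : Matrix (Fin n) (Fin n) (DKR R),
    ∀ x ∈ latR R n (-k), matActK E x - ∑ w, winProj R n k x w • u w ∈ latR R n k := by
  -- Precision `3k` is enough: the later multiplication by `u z^{-i}` costs at most `k + i < 2k`.
  have : ∀ i : ↥(Finset.Ico (-k : ℤ) k), ∃ P : DK, ∀ (S : Type) [CommRing S] [Algebra ℂ S],
      ∀ x ∈ latB S (-k), actK S (1 ⊗ₜ P) x - coeffR S i x • zK S i ∈ latB S (3 * k) := fun i =>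
    exists_monomialProjR (by have := Finset.mem_Ico.1 i.2; rw [Finset.mem_Ico]; omega)
  choose P hP using this
  -- `P i` isolates the `z^i` term of the `b`-th entry, and multiplication by `u z^{-i}` replaces
  -- `z^i` by the prescribed value.
  refine ⟨Matrix.of fun a b => ∑ i, mulR R (u (b, i) a * zK R (-i)) * 1 ⊗ₜ P i, fun x hx => ?_⟩
  refine mem_latR.2 fun a => ?_
  have e : (matActK (Matrix.of fun a b => ∑ i, mulR R (u (b, i) a * zK R (-i)) * 1 ⊗ₜ P i) x -
      ∑ w, winProj R n k x w • u w) a = ∑ b, ∑ i : ↥(Finset.Ico (-k : ℤ) k),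
        u (b, i) a * zK R (-i) * (actK R (1 ⊗ₜ P i) (x b) - coeffR R i (x b) • zK R i) := by
    rw [Pi.sub_apply, matActK_apply, Finset.sum_apply, Fintype.sum_prod_type,
      ← Finset.sum_sub_distrib]
    refine Finset.sum_congr rfl fun b _ => ?_
    rw [Matrix.of_apply, map_sum, LinearMap.sum_apply, ← Finset.sum_sub_distrib]
    refine Finset.sum_congr rfl fun i _ => ?_
    rw [map_mul, Module.End.mul_apply, actK_mulR, mul_sub, mul_smul_comm, mul_assoc (u (b, i) a),
      mul_assoc (u (b, i) a), zK_mul_zK, neg_add_cancel, zK_zero, mul_one]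
    rfl
  rw [e]
  refine sum_mem fun b _ => sum_mem fun i _ => ?_
  have hi := Finset.mem_Ico.1 i.2
  exact latB_anti (by omega) (mul_mem_latB
    (mul_mem_latB (mem_latR.1 (hu (b, i)) a) (zK_mem_latB le_rfl)) (hP i R _ (mem_latR.1 hx b)))

/-- A lattice whose window is an image of a projection is cut out by an approximate idempotent. -/
theorem exists_isIdem {k : ℕ} {L : Submodule R (Fin n → KR R)} (hL : latR R n k ≤ L)
    (hL' : L ≤ latR R n (-k)) (p : (Window n k → R) →ₗ[R] (Fin n → KR R)) (hp : ∀ c, p c ∈ L)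
    (hp' : ∀ c, winEmb R n k c ∈ L → p c = winEmb R n k c) :
    ∃ E : Matrix (Fin n) (Fin n) (DKR R), IsIdem k E ∧ L = idemK k E := by
  classical
  obtain ⟨E, hE⟩ := exists_matActK_window k (fun w => p (Pi.single w 1)) fun w => hL' (hp _)
  -- Modulo `z^k`, the matrix `E` is truncation to the window followed by `p`; the required bounds
  -- follow as `p` takes values in `L` and fixes the window part of `L`.
  have hE' : ∀ x ∈ latR R n (-k), matActK E x - p (winProj R n k x) ∈ latR R n k := fun x hx => by
    convert hE x hx using 2
    conv_lhs => rw [pi_eq_sum_univ' (winProj R n k x), map_sum]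
    refine Finset.sum_congr rfl fun w _ => ?_
    rw [map_smul]
  have hEL : ∀ x ∈ latR R n (-k), matActK E x ∈ L := fun x hx => by
    have := add_mem (hL (hE' x hx)) (hp (winProj R n k x))
    rwa [sub_add_cancel] at this
  have hEpos : ∀ x ∈ latR R n k, matActK E x ∈ latR R n k := fun x hx => by
    have := hE' x (latR_anti (by omega) hx)
    rwa [winProj_eq_zero hx, map_zero, sub_zero] at this
  have hfix : ∀ x ∈ L, matActK (1 - E) x ∈ latR R n k := fun x hx => by
    have h1 := hE' x (hL' hx)
    rw [hp' _ ((mem_iff_winEmb_mem hL (hL' hx)).1 hx)] at h1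
    have h2 := sub_mem (sub_winEmb_mem (hL' hx)) h1
    rwa [sub_sub_sub_cancel_right, ← matActK_one (R := R) x, ← matActK_mul, mul_one,
      ← matActK_sub] at h2
  refine ⟨E, ⟨Bdd.of_matActK fun x hx => hL' (hEL x hx), Bdd.of_matActK hEpos,
    Bdd.of_matActK fun x hx => ?_⟩, le_antisymm (fun x hx => ⟨hL' hx, hfix x hx⟩) ?_⟩
  · have := (latR R n k).neg_mem (hfix _ (hEL x hx))
    rwa [← matActK_mul, sub_mul, one_mul, matActK_sub, neg_sub, ← matActK_sub] at this
  · rintro x ⟨hx, hx'⟩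
    have := add_mem (hEL x hx) (hL hx')
    rwa [matActK_sub, matActK_one, add_sub_cancel] at this

/-- A section `s` of the projective quotient makes `1 - s ∘ mkQ` a projection onto `L`; its
restriction to the window feeds `SatoGr.exists_isIdem`. -/
theorem IsSato.exists_isIdem {L : Submodule R (Fin n → KR R)} (hL : IsSato L) :
    ∃ (k : ℕ) (E : Matrix (Fin n) (Fin n) (DKR R)), IsIdem k E ∧ L = idemK k E := by
  obtain ⟨k, h1, h2⟩ := hL.commensurable
  have := hL.projective_coker
  obtain ⟨s, hs⟩ := Module.projective_lifting_property L.mkQ LinearMap.id L.mkQ_surjective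
  refine ⟨k, SatoGr.exists_isIdem h1 h2 (winEmb R n k - s ∘ₗ L.mkQ ∘ₗ winEmb R n k)
    (fun c => ?_) fun c hc => ?_⟩
  · rw [← Submodule.Quotient.mk_eq_zero, ← Submodule.mkQ_apply, LinearMap.sub_apply, map_sub]
    exact sub_eq_zero.2 (LinearMap.congr_fun hs _).symm
  · have h0 : L.mkQ (winEmb R n k c) = 0 := (Submodule.Quotient.mk_eq_zero L).2 hc
    rw [LinearMap.sub_apply, LinearMap.comp_apply, LinearMap.comp_apply, h0, map_zero, sub_zero]

/-! ### From `D`-modules to approximate idempotents -/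

theorem IsGrD.mem_iff {M : DSub R n} (hM : IsGrD M) {v : Fin n → DKR R} :
    v ∈ M ↔ ∀ x ∈ latB R 0, vact v x ∈ deRham M :=
  ⟨fun h _ hx => mem_deRham_of_mem h hx, mem_of_vact_mem_deRham hM.iso_off_point⟩

theorem exists_vact_shift (s : Finset (Fin n → DKR R)) :
    ∃ d : ℕ, ∀ v ∈ s, ∀ (a : ℤ), ∀ x ∈ latB R a, vact v x ∈ latR R n (a - d) := by
  choose d hd using fun P : DKR R => exists_actK_shift P
  refine ⟨∑ v ∈ s, ∑ i, d (v i), fun v hv a x hx => mem_latR.2 fun i => ?_⟩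
  refine latB_anti ?_ (hd (v i) a x hx)
  have h1 : d (v i) ≤ ∑ i, d (v i) :=
    Finset.single_le_sum (f := fun i => d (v i)) (fun _ _ => Nat.zero_le _) (Finset.mem_univ i)
  have h2 : ∑ i, d (v i) ≤ ∑ v ∈ s, ∑ i, d (v i) :=
    Finset.single_le_sum (f := fun v => ∑ i, d (v i)) (fun _ _ => Nat.zero_le _) hv
  omega

theorem IsGrD.exists_zD_le {M : DSub R n} (hM : IsGrD M) : ∃ N : ℕ, zD R n N ≤ M := by
  classical
  choose N hN using fun j : Fin n => hM.iso_off_point (Pi.single j 1)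
  refine ⟨∑ j, N j, fun v hv => ?_⟩
  -- With `N = ∑ N j`, write `v j = z^{N j} · z^{N - N j} · (z^{-N} v j)`: the first factor puts
  -- `e_j` in `M`, the others lie in `D(O)`.
  have e : v = ∑ j, rmul (rmul (Pi.single j 1) (zpowR R (N j)))
      (zpowR R ((∑ j, N j : ℕ) - N j) * (zpowR R (-(∑ j, N j : ℕ)) * v j)) := by
    funext i
    rw [Finset.sum_apply, Finset.sum_eq_single i]
    · rw [rmul, rmul, Pi.single_eq_same, one_mul, ← mul_assoc, ← mul_assoc, zpowR_mul_zpowR,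
        zpowR_mul_zpowR, show (N i : ℤ) + ((∑ j, N j : ℕ) - N i) + -(∑ j, N j : ℕ) = 0 by ring,
        zpowR_zero, one_mul]
    · intro j _ hj
      rw [rmul, rmul, Pi.single_eq_of_ne hj.symm, zero_mul, zero_mul]
    · simp
  rw [e]
  refine sum_mem fun j _ => rmul_mem (hN j) (mul_mem_DOR (zpowR_mem_DOR ?_) (hv j))
  have : N j ≤ ∑ j, N j := Finset.single_le_sum (fun _ _ => Nat.zero_le _) (Finset.mem_univ j)
  omega

/-- Finitely many generators lower orders by at most some `d`, which bounds `h(M)` below. Modulo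
`z^k`, the value of a generator at `x` depends only on the coefficients of `x` below `k + d`, which
gives finite generation in the window. -/
theorem IsGrD.exists_finite_window {M : DSub R n} (hM : IsGrD M) : ∃ k : ℕ,
    latR R n k ≤ deRham M ∧ deRham M ≤ latR R n (-k) ∧
      ((deRham M).comap (winEmb R n k)).FG := by
  classical
  have := hM.finitePresentation
  have : Module.Finite (DOR R).op M := inferInstance
  obtain ⟨s, hs⟩ := Module.Finite.iff_fg.1 this
  obtain ⟨d, hd⟩ := exists_vact_shift s
  obtain ⟨N, hN⟩ := hM.exists_zD_le
  obtain ⟨k, hdk, hNk⟩ : ∃ k : ℕ, d ≤ k ∧ N ≤ k := ⟨max d N, le_max_left _ _, le_max_right _ _⟩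
  have hpos : latR R n k ≤ deRham M := by
    rw [← deRham_zD]
    exact deRham_mono ((zD_anti (by omega)).trans hN)
  have hind : ∀ {p : (Fin n → DKR R) → Prop}, (∀ v ∈ s, p v) → p 0 →
      (∀ v w, p v → p w → p (v + w)) → (∀ v, ∀ P ∈ DOR R, p v → p (rmul v P)) →
      ∀ v ∈ M, p v := fun h1 h2 h3 h4 v hv =>
    span_induction_DSub (s := s) h1 h2 h3 h4 (by rwa [hs])
  have hneg : deRham M ≤ latR R n (-k) := by
    intro x hx
    obtain ⟨m, hm, rfl⟩ := exists_of_mem_deRham hx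
    have : ∀ x ∈ latB R 0, vact m x ∈ latR R n (-k) := by
      refine hind (p := fun m => ∀ x ∈ latB R 0, vact m x ∈ latR R n (-k)) ?_ ?_ ?_ ?_ m hm
      · intro v hv x hx
        exact latR_anti (by omega) (hd v hv 0 x hx)
      · intro x _; rw [vact_zero_left]; exact zero_mem _
      · intro v w h h' x hx; rw [vact_add_left]; exact add_mem (h x hx) (h' x hx)
      · intro v P hP h x hx; rw [vact_rmul]; exact h _ (actK_mem_of_mem_DOR hP hx)
    exact this 1 one_mem_latB
  refine ⟨k, hpos, hneg, ?_⟩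
  obtain ⟨T, hT⟩ : ∃ T : Finset (Window n k → R), T = (s ×ˢ Finset.Ico (0 : ℤ) (k + d)).image
    fun q => winProj R n k (vact q.1 (zK R q.2)) := ⟨_, rfl⟩
  refine ⟨T, le_antisymm (Submodule.span_le.2 fun c hc => ?_) fun c hc => ?_⟩
  · simp only [hT, Finset.coe_image, Set.mem_image, Finset.mem_coe, Finset.mem_product,
      Finset.mem_Ico] at hc
    obtain ⟨⟨v, j⟩, ⟨hv, hj, -⟩, rfl⟩ := hc
    have hvM : v ∈ M := hs ▸ Submodule.subset_span hv
    have hL : vact v (zK R j) ∈ deRham M := mem_deRham_of_mem hvM (zK_mem_latB hj)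
    exact (mem_iff_winEmb_mem hpos (hneg hL)).1 hL
  · have hc' : winEmb R n k c ∈ deRham M := hc
    obtain ⟨m, hm, e⟩ := exists_of_mem_deRham hc'
    rw [← winProj_winEmb k c, ← e]
    -- All `x ∈ O` are needed, not only `x = 1`: right multiplication changes the argument, `(m
    -- P)(x) = m(P x)`.
    have : ∀ x ∈ latB R 0,
        winProj R n k (vact m x) ∈ Submodule.span R (T : Set (Window n k → R)) := by
      refine hind (p := fun m => ∀ x ∈ latB R 0, winProj R n k (vact m x) ∈
        Submodule.span R (T : Set (Window n k → R))) ?_ ?_ ?_ ?_ m hm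
      · intro v hv x hx
        have h1 := hd v hv _ _ (sub_window_mem_latB hx (k + d))
        rw [add_sub_cancel_right] at h1
        have h2 := winProj_eq_zero h1
        have h3 : vact v x = vact v (x - ∑ i ∈ Finset.Ico (0 : ℤ) (k + d), coeffR R i x • zK R i) +
            ∑ i ∈ Finset.Ico (0 : ℤ) (k + d), coeffR R i x • vact v (zK R i) := by
          funext b
          simp [vact]
        rw [h3, map_add, h2, zero_add, map_sum]
        refine sum_mem fun i hi => ?_
        rw [map_smul]
        refine Submodule.smul_mem _ _ (Submodule.subset_span ?_)
        rw [hT]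
        exact Finset.mem_coe.2 (Finset.mem_image.2 ⟨(v, i), Finset.mem_product.2 ⟨hv, hi⟩, rfl⟩)
      · intro x _; rw [vact_zero_left, map_zero]; exact zero_mem _
      · intro v w h h' x hx; rw [vact_add_left, map_add]; exact add_mem (h x hx) (h' x hx)
      · intro v P hP h x hx; rw [vact_rmul]; exact h _ (actK_mem_of_mem_DOR hP hx)
    exact this 1 one_mem_latB

/-- The flatness given is that of `D^n/M`, whereas a projection of the window to `h(M)` is wanted.
Functions are therefore lifted to columns of operators, where the equational criterion applies, and
the result is evaluated at `1`. -/
theorem IsGrD.exists_isIdem_deRham {M : DSub R n} (hM : IsGrD M) :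
    ∃ (k : ℕ) (E : Matrix (Fin n) (Fin n) (DKR R)), IsIdem k E ∧ deRham M = idemK k E := by
  obtain ⟨k, hpos, hneg, hfg⟩ := hM.exists_finite_window
  refine ⟨k, ?_⟩
  have : Module.Finite R ((deRham M).comap (winEmb R n k)) := Module.Finite.iff_fg.2 hfg
  have := hM.flat_coker
  -- `T` approximates `y ↦ y(0)`, so the column `x T` sends `y` to `y(0) x` modulo `z^k`. The
  -- exponent `2k` absorbs the pole of `x`; the extra `1` keeps the interval nonempty when `k = 0`.
  obtain ⟨T, hT⟩ : ∃ T : DKR R, ∀ x ∈ latB R 0, actK R T x - coeffR R 0 x • zK R 0 ∈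
      latB R (2 * k + 1) := by
    obtain ⟨P, hP⟩ := exists_monomialProjR (a := 0) (b := 2 * k + 1) (i := 0)
      (by rw [Finset.mem_Ico]; omega)
    exact ⟨1 ⊗ₜ P, hP R⟩
  let Tc : (Fin n → KR R) →ₗ[R] (Fin n → DKR R) :=
    LinearMap.pi fun i => LinearMap.mulRight R T ∘ₗ (mulR R).toLinearMap ∘ₗ LinearMap.proj i
  have hTc : ∀ x ∈ latR R n (-k), ∀ y ∈ latB R 0,
      vact (Tc x) y - coeffR R 0 y • x ∈ latR R n k := by
    intro x hx y hy
    refine mem_latR.2 fun i => ?_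
    have e : (vact (Tc x) y - coeffR R 0 y • x) i =
        x i * (actK R T y - coeffR R 0 y • zK R 0) := by
      change actK R (mulR R (x i) * T) y - coeffR R 0 y • x i = _
      rw [map_mul, Module.End.mul_apply, actK_mulR, mul_sub, mul_smul_comm, zK_zero, mul_one]
    rw [e]
    exact latB_anti (by omega) (mul_mem_latB (mem_latR.1 hx i) (hT y hy))
  let s : (Window n k → R) →ₗ[R] (Fin n → DKR R) ⧸ M.restrictScalars R :=
    (M.restrictScalars R).mkQ ∘ₗ Tc ∘ₗ winEmb R n k
  -- If `x ∈ h(M)`, then `x T` maps `O` into `h(M)`, and so lies in `M`.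
  have hs : s ∘ₗ ((deRham M).comap (winEmb R n k)).subtype = 0 := by
    refine LinearMap.ext fun c => ?_
    refine (Submodule.Quotient.mk_eq_zero _).2 (hM.mem_iff.2 fun y hy => ?_)
    have := add_mem (hpos (hTc _ (winEmb_mem k c.1) y hy))
      (Submodule.smul_mem _ (coeffR R 0 y) c.2)
    rwa [sub_add_cancel] at this
  -- As `D^n/M` is flat and the window part of `h(M)` is finitely generated, `s` factors as `y ∘ a`
  -- through a finite free module, with `a` killing that part.
  obtain ⟨m, a, y, hya, ha⟩ := Module.Flat.exists_factorization_of_comp_eq_zero_of_free hs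
  let ev : (Fin n → DKR R) →ₗ[R] (Fin n → KR R) :=
    LinearMap.pi fun i => LinearMap.applyₗ (1 : KR R) ∘ₗ (actK R).toLinearMap ∘ₗ LinearMap.proj i
  let q : ((Fin n → DKR R) ⧸ M.restrictScalars R) →ₗ[R] (Fin n → KR R) ⧸ deRham M :=
    (M.restrictScalars R).liftQ ((deRham M).mkQ ∘ₗ ev) fun v hv =>
      (Submodule.Quotient.mk_eq_zero _).2 (mem_deRham_of_mem hv one_mem_latB)
  obtain ⟨h, hh⟩ := Module.projective_lifting_property (deRham M).mkQ (q ∘ₗ y)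
    (deRham M).mkQ_surjective
  -- Modulo `h(M)`, `h (a c)` is the value of `x T` at `1`, namely `x` itself, where `x = winEmb c`.
  -- So the difference lands in `h(M)`, and it is the identity where `a` vanishes.
  refine exists_isIdem hpos hneg (winEmb R n k - h ∘ₗ a) (fun c => ?_) fun c hc => ?_
  · have h1 : (deRham M).mkQ (h (a c)) = (deRham M).mkQ (vact (Tc (winEmb R n k c)) 1) :=
      (LinearMap.congr_fun hh (a c)).trans (congrArg q (LinearMap.congr_fun hya c).symm)
    have h2 : (deRham M).mkQ (vact (Tc (winEmb R n k c)) 1 - winEmb R n k c) = 0 := by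
      have := hTc _ (winEmb_mem k c) 1 one_mem_latB
      rw [← zK_zero, coeffR_zK, if_pos rfl, one_smul] at this
      exact (Submodule.Quotient.mk_eq_zero _).2 (hpos this)
    rw [← Submodule.Quotient.mk_eq_zero, ← Submodule.mkQ_apply, LinearMap.sub_apply, map_sub,
      LinearMap.comp_apply, h1, ← map_sub, ← neg_sub, map_neg, h2, neg_zero]
  · have h0 : a c = 0 := LinearMap.congr_fun ha ⟨c, hc⟩
    rw [LinearMap.sub_apply, LinearMap.comp_apply, h0, map_zero, sub_zero]

/-- Points of the adèlic Grassmannian are cut out by approximate idempotents. -/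
theorem IsGrD.exists_isIdem {M : DSub R n} (hM : IsGrD M) :
    ∃ (k : ℕ) (E : Matrix (Fin n) (Fin n) (DKR R)), IsIdem k E ∧ M = idemD k E := by
  obtain ⟨k, E, hE, h⟩ := hM.exists_isIdem_deRham
  refine ⟨k, E, hE, ?_⟩
  ext v
  rw [hM.mem_iff, h, hE.isGrD.mem_iff, hE.deRham_idemD]

theorem bijOn_deRham : Set.BijOn (deRham : DSub R n → _) {M | IsGrD M} {L | IsSato L} := by
  refine ⟨fun M hM => ?_, fun M hM N hN e => ?_, fun L hL => ?_⟩
  · obtain ⟨k, E, hE, h⟩ := hM.exists_isIdem_deRham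
    exact h ▸ hE.isSato
  · ext v
    rw [hM.mem_iff, hN.mem_iff, e]
  · obtain ⟨k, E, hE, rfl⟩ := IsSato.exists_isIdem hL
    exact ⟨idemD k E, hE.isGrD, hE.deRham_idemD⟩

end

/-! ### Base change -/

section

variable {R S T : Type} [CommRing R] [Algebra ℂ R] [CommRing S] [Algebra ℂ S] [CommRing T]
  [Algebra ℂ T] {n : ℕ}

/-- Extension of scalars of differential operators. -/
def mapD (f : R →ₐ[ℂ] S) : DKR R →ₐ[ℂ] DKR S := Algebra.TensorProduct.map f (AlgHom.id ℂ DK)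

/-- Extension of scalars of Laurent series. -/
def mapK (f : R →ₐ[ℂ] S) : KR R →ₗ[ℂ] KR S :=
  TensorProduct.map f.toLinearMap (LinearMap.id : K →ₗ[ℂ] K)

/-- Extension of scalars of columns of differential operators. -/
def mapV (f : R →ₐ[ℂ] S) (v : Fin n → DKR R) : Fin n → DKR S := fun i => mapD f (v i)

theorem mapD_tmul (f : R →ₐ[ℂ] S) (r : R) (P : DK) : mapD f (r ⊗ₜ P) = f r ⊗ₜ P := rfl

theorem mapK_tmul (f : R →ₐ[ℂ] S) (r : R) (g : K) : mapK f (r ⊗ₜ g) = f r ⊗ₜ g := rfl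

theorem mapD_smul (f : R →ₐ[ℂ] S) (r : R) (P : DKR R) : mapD f (r • P) = f r • mapD f P := by
  induction P using TensorProduct.induction_on with
  | zero => simp
  | tmul s P => simp [mapD_tmul, TensorProduct.smul_tmul']
  | add P Q h h' => rw [smul_add, map_add, map_add, h, h', smul_add]

theorem mapD_comp (g : S →ₐ[ℂ] T) (f : R →ₐ[ℂ] S) (P : DKR R) :
    mapD g (mapD f P) = mapD (g.comp f) P := by
  induction P using TensorProduct.induction_on with
  | zero => simp
  | tmul s P => rfl
  | add P Q h h' => rw [map_add, map_add, map_add, h, h']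

theorem mapD_id (P : DKR R) : mapD (AlgHom.id ℂ R) P = P := by
  induction P using TensorProduct.induction_on with
  | zero => simp
  | tmul s P => rfl
  | add P Q h h' => rw [map_add, h, h']

theorem mapK_actK (f : R →ₐ[ℂ] S) (P : DKR R) (x : KR R) :
    mapK f (actK R P x) = actK S (mapD f P) (mapK f x) := by
  induction P using TensorProduct.induction_on with
  | zero => simp
  | tmul r P =>
    induction x using TensorProduct.induction_on with
    | zero => simp
    | tmul s g => rw [actK_tmul, mapD_tmul, mapK_tmul, mapK_tmul, actK_tmul, map_mul]
    | add x y h h' => simp only [map_add, h, h']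
  | add P Q h h' => simp only [map_add, LinearMap.add_apply, h, h']

theorem mapD_mem_DOR (f : R →ₐ[ℂ] S) {P : DKR R} (hP : P ∈ DOR R) : mapD f P ∈ DOR S := by
  induction hP using DOR_induction with
  | tmul r P hP => exact tmul_mem_DOR _ hP
  | add x y _ _ h h' => rw [map_add]; exact add_mem h h'

theorem mapD_zpowR (f : R →ₐ[ℂ] S) (k : ℤ) : mapD f (zpowR R k) = zpowR S k := by
  rw [zpowR, mapD_tmul, map_one]; rfl

theorem matMap_apply (f : R →ₐ[ℂ] S) (g : Matrix (Fin n) (Fin n) (DKR R)) (i j : Fin n) :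
    matMap f g i j = mapD f (g i j) := rfl

theorem matMap_mul (f : R →ₐ[ℂ] S) (g h : Matrix (Fin n) (Fin n) (DKR R)) :
    matMap f (g * h) = matMap f g * matMap f h := Matrix.map_mul (f := mapD f)

theorem matMap_sub (f : R →ₐ[ℂ] S) (g h : Matrix (Fin n) (Fin n) (DKR R)) :
    matMap f (g - h) = matMap f g - matMap f h := Matrix.map_sub (mapD f) (map_sub _) g h

theorem matMap_add (f : R →ₐ[ℂ] S) (g h : Matrix (Fin n) (Fin n) (DKR R)) :
    matMap f (g + h) = matMap f g + matMap f h := Matrix.map_add (mapD f) (map_add _) g h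

theorem matMap_one (f : R →ₐ[ℂ] S) : matMap f (1 : Matrix (Fin n) (Fin n) (DKR R)) = 1 :=
  Matrix.map_one (mapD f) (map_zero _) (map_one _)

theorem matMap_smul (f : R →ₐ[ℂ] S) (r : R) (g : Matrix (Fin n) (Fin n) (DKR R)) :
    matMap f (r • g) = f r • matMap f g := Matrix.ext fun _ _ => mapD_smul f r _

theorem matMap_comp (g : S →ₐ[ℂ] T) (f : R →ₐ[ℂ] S) (A : Matrix (Fin n) (Fin n) (DKR R)) :
    matMap g (matMap f A) = matMap (g.comp f) A := Matrix.ext fun _ _ => mapD_comp g f _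

theorem matMap_id (A : Matrix (Fin n) (Fin n) (DKR R)) : matMap (AlgHom.id ℂ R) A = A :=
  Matrix.ext fun _ _ => mapD_id _

theorem matMap_constMat (f : R →ₐ[ℂ] S) (ξ : DGl n) :
    matMap f (constMat R ξ) = constMat S ξ :=
  Matrix.ext fun i j => by
    change mapD f (1 ⊗ₜ ξ i j) = 1 ⊗ₜ ξ i j
    rw [mapD_tmul, map_one]

theorem matMap_onePlus (f : R →ₐ[ℂ] S) (e : R) (ξ : Matrix (Fin n) (Fin n) (DKR R)) :
    matMap f (onePlus e ξ) = onePlus (f e) (matMap f ξ) := by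
  rw [onePlus, matMap_add, matMap_one, matMap_smul, onePlus]

theorem mapV_leftMul (f : R →ₐ[ℂ] S) (g : Matrix (Fin n) (Fin n) (DKR R)) (v : Fin n → DKR R) :
    mapV f (leftMul g v) = leftMul (matMap f g) (mapV f v) := by
  funext i
  simp [mapV, leftMul_apply, Matrix.mulVec, dotProduct, matMap_apply]

theorem mapV_mem_push (f : R →ₐ[ℂ] S) {M : DSub R n} {v : Fin n → DKR R} (hv : v ∈ M) :
    mapV f v ∈ push f M := Submodule.subset_span ⟨v, hv, rfl⟩

theorem push_le_iff {f : R →ₐ[ℂ] S} {M : DSub R n} {N : DSub S n} :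
    push f M ≤ N ↔ ∀ v ∈ M, mapV f v ∈ N := by
  rw [push, Submodule.span_le, Set.image_subset_iff]
  rfl

theorem push_mono (f : R →ₐ[ℂ] S) {M N : DSub R n} (h : M ≤ N) : push f M ≤ push f N :=
  push_le_iff.2 fun _ hv => mapV_mem_push f (h hv)

theorem push_map (f : R →ₐ[ℂ] S) (g : Matrix (Fin n) (Fin n) (DKR R)) (M : DSub R n) :
    push f (M.map (leftMul g)) = (push f M).map (leftMul (matMap f g)) := by
  refine le_antisymm (push_le_iff.2 ?_) (Submodule.map_le_iff_le_comap.2 (push_le_iff.2 ?_))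
  · rintro _ ⟨v, hv, rfl⟩
    rw [mapV_leftMul]
    exact Submodule.mem_map_of_mem (mapV_mem_push f hv)
  · intro v hv
    rw [Submodule.mem_comap, ← mapV_leftMul]
    exact mapV_mem_push f (Submodule.mem_map_of_mem hv)

theorem push_push (g : S →ₐ[ℂ] T) (f : R →ₐ[ℂ] S) (M : DSub R n) :
    push g (push f M) = push (g.comp f) M := by
  have e : ∀ v : Fin n → DKR R, mapV g (mapV f v) = mapV (g.comp f) v :=
    fun v => funext fun i => mapD_comp g f _
  refine le_antisymm (push_le_iff.2 fun v hv => ?_) (push_le_iff.2 fun v hv => ?_)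
  · refine span_induction_DSub (p := fun v => mapV g v ∈ push (g.comp f) M) ?_ ?_ ?_ ?_ hv
    · rintro _ ⟨w, hw, rfl⟩
      have := mapV_mem_push (g.comp f) hw
      rwa [← e] at this
    · convert zero_mem (push (g.comp f) M) using 1
      funext i; simp [mapV]
    · intro v w hv hw
      convert add_mem hv hw using 1
      funext i; simp [mapV]
    · intro v P hP hv
      convert rmul_mem hv (mapD_mem_DOR g hP) using 1
      funext i; simp [mapV, rmul]
  · rw [← e]
    exact mapV_mem_push g (mapV_mem_push f hv)

theorem push_id (M : DSub R n) : push (AlgHom.id ℂ R) M = M := by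
  have e : ∀ v : Fin n → DKR R, mapV (AlgHom.id ℂ R) v = v := fun v => funext fun i => mapD_id _
  refine le_antisymm (push_le_iff.2 fun v hv => by rwa [e]) fun v hv => ?_
  have := mapV_mem_push (AlgHom.id ℂ R) hv
  rwa [e] at this

theorem mapV_mem_zD (f : R →ₐ[ℂ] S) {b : ℤ} {v : Fin n → DKR R} (hv : v ∈ zD R n b) :
    mapV f v ∈ zD S n b := fun i => by
  rw [mapV, ← mapD_zpowR f, ← map_mul]
  exact mapD_mem_DOR f (hv i)

theorem push_zD (f : R →ₐ[ℂ] S) (b : ℤ) : push f (zD R n b) = zD S n b := by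
  classical
  refine le_antisymm (push_le_iff.2 fun v hv => mapV_mem_zD f hv) fun v hv => ?_
  have e : v = ∑ j, rmul (mapV f (Pi.single j (zpowR R b))) (zpowR S (-b) * v j) := by
    funext i
    rw [Finset.sum_apply, Finset.sum_eq_single i]
    · rw [rmul, mapV, Pi.single_eq_same, mapD_zpowR, ← mul_assoc, zpowR_mul_zpowR, add_neg_cancel,
        zpowR_zero, one_mul]
    · intro j _ hj
      rw [rmul, mapV, Pi.single_eq_of_ne hj.symm, map_zero, zero_mul]
    · simp
  rw [e]
  refine sum_mem fun j _ => rmul_mem (mapV_mem_push f fun i => ?_) (hv j)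
  rcases eq_or_ne i j with rfl | h
  · rw [Pi.single_eq_same, zpowR_mul_zpowR, neg_add_cancel, zpowR_zero]
    exact one_mem _
  · rw [Pi.single_eq_of_ne h, mul_zero]
    exact zero_mem _

theorem push_unitPt (f : R →ₐ[ℂ] S) : push f (unitPt R n) = unitPt S n := by
  rw [unitPt_eq_zD, unitPt_eq_zD, push_zD]

theorem bdd_iff_map_le {a b : ℤ} {A : Matrix (Fin n) (Fin n) (DKR R)} :
    Bdd a b A ↔ (zD R n a).map (leftMul A) ≤ zD R n b :=
  (Submodule.map_le_iff_le_comap (f := leftMul A) (p := zD R n a) (q := zD R n b)).symm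

theorem Bdd.matMap (f : R →ₐ[ℂ] S) {a b : ℤ} {A : Matrix (Fin n) (Fin n) (DKR R)}
    (hA : Bdd a b A) : Bdd a b (matMap f A) := by
  rw [bdd_iff_map_le] at hA ⊢
  rw [← push_zD f, ← push_map, ← push_zD f]
  exact push_mono f hA

theorem IsIdem.matMap (f : R →ₐ[ℂ] S) {k : ℕ} {E : Matrix (Fin n) (Fin n) (DKR R)}
    (hE : IsIdem k E) : IsIdem k (matMap f E) :=
  ⟨hE.neg.matMap f, hE.pos.matMap f, by
    rw [← matMap_mul, ← matMap_sub]; exact hE.idem.matMap f⟩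

/-- One inclusion transports the two defining conditions. The other uses the description as a sum,
since images and sums commute with base change. -/
theorem IsIdem.push_idemD (f : R →ₐ[ℂ] S) {k : ℕ} {E : Matrix (Fin n) (Fin n) (DKR R)}
    (hE : IsIdem k E) : push f (idemD k E) = idemD k (SatoGr.matMap f E) := by
  refine le_antisymm (push_le_iff.2 fun v hv => ⟨mapV_mem_zD f hv.1, ?_⟩) fun v hv => ?_
  · have := mapV_mem_zD f hv.2
    rwa [mapV_leftMul, matMap_sub, matMap_one] at this
  · rw [idemD_eq_add (E := SatoGr.matMap f E) v]
    refine add_mem (push_mono f hE.map_le ?_) (push_mono f hE.zD_le ?_)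
    · rw [push_map, push_zD]
      exact Submodule.mem_map_of_mem hv.1
    · rw [push_zD]; exact hv.2

theorem IsGrD.push (f : R →ₐ[ℂ] S) {M : DSub R n} (hM : IsGrD M) : IsGrD (push f M) := by
  obtain ⟨k, E, hE, rfl⟩ := hM.exists_isIdem
  rw [hE.push_idemD]
  exact (hE.matMap f).isGrD

theorem deRham_push (f : R →ₐ[ℂ] S) (M : DSub R n) :
    deRham (push f M) = pushK f (deRham M) := by
  have e : ∀ (v : Fin n → DKR R) (x : KR R),
      vact (mapV f v) (mapK f x) = fun i => mapK f (vact v x i) :=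
    fun v x => funext fun i => (mapK_actK f (v i) x).symm
  have h1 : mapK f (1 : KR R) = 1 := by
    rw [Algebra.TensorProduct.one_def, mapK_tmul, map_one]; rfl
  refine le_antisymm (fun x hx => ?_) (Submodule.span_le.2 ?_)
  · obtain ⟨m, hm, rfl⟩ := exists_of_mem_deRham hx
    have : ∀ y ∈ latB S 0, vact m y ∈ pushK f (deRham M) := by
      refine span_induction_DSub
        (p := fun m => ∀ y ∈ latB S 0, vact m y ∈ pushK f (deRham M)) ?_ ?_ ?_ ?_ hm
      · rintro _ ⟨w, hw, rfl⟩ y hy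
        induction hy using latB_induction with
        | tmul g hg =>
          refine Submodule.subset_span ⟨vact w (1 ⊗ₜ g), mem_deRham_of_mem hw
            (tmul_mem_latB 1 hg), ?_⟩
          refine (e w (1 ⊗ₜ g)).symm.trans ?_
          rw [mapK_tmul, map_one]
          rfl
        | add x y _ _ h h' => rw [vact_add]; exact add_mem h h'
        | smul r x _ h => rw [vact_smul]; exact Submodule.smul_mem _ r h
      · intro y _; rw [vact_zero_left]; exact zero_mem _
      · intro v w h h' y hy; rw [vact_add_left]; exact add_mem (h y hy) (h' y hy)
      · intro v P hP h y hy; rw [vact_rmul]; exact h _ (actK_mem_of_mem_DOR hP hy)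
    exact this 1 one_mem_latB
  · rintro _ ⟨x, hx, rfl⟩
    obtain ⟨m, hm, rfl⟩ := exists_of_mem_deRham hx
    refine mem_deRham_iff.2 ⟨mapV f m, mapV_mem_push f hm, ?_⟩
    rw [← h1, e]
    rfl

theorem isSatoIdentification (n : ℕ) : IsSatoIdentification n where
  push_mem _ _ _ _ _ _ f _ hM := hM.push f
  bijective _ _ _ := bijOn_deRham
  natural _ _ _ _ _ _ f M _ := deRham_push f M
  equivariant _ _ _ _ _ M _ _ := deRham_map _ M

/-! ### The infinitesimal action -/

theorem IsGrD.map_of_inverse {M : DSub R n} (hM : IsGrD M) {g h : Matrix (Fin n) (Fin n) (DKR R)}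
    (hgh : g * h = 1) (hhg : h * g = 1) : IsGrD (M.map (leftMul g)) := by
  let e : (Fin n → DKR R) ≃ₗ[(DOR R).op] (Fin n → DKR R) :=
    LinearEquiv.ofLinearMap (leftMul g) (leftMul h)
      (LinearMap.ext fun v => by
        change leftMul g (leftMul h v) = v
        rw [← leftMul_mul, hgh, leftMul_one])
      (LinearMap.ext fun v => by
        change leftMul h (leftMul g v) = v
        rw [← leftMul_mul, hhg, leftMul_one])
  let eM : M ≃ₗ[(DOR R).op] M.map (leftMul g) := e.submoduleMap M
  let eR : (Fin n → DKR R) ≃ₗ[R] (Fin n → DKR R) := e.restrictScalars R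
  have hmap : (M.restrictScalars R).map eR.toLinearMap =
      (M.map (leftMul g)).restrictScalars R := rfl
  refine ⟨?_, ?_, fun v => ?_, ?_⟩
  · have := hM.flat
    exact Module.Flat.of_linearEquiv (eR.submoduleMap (M.restrictScalars R)).symm
  · have := hM.finitePresentation
    exact Module.FinitePresentation.of_equiv (R := (DOR R).op) (M := M)
      (N := M.map (leftMul g)) eM
  · obtain ⟨N, hN⟩ := hM.iso_off_point (leftMul h v)
    refine ⟨N, ?_⟩
    have := Submodule.mem_map_of_mem (f := leftMul g) hN
    change leftMul g (rmul (leftMul h v) _) ∈ _ at this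
    rw [← rmul_leftMul, ← leftMul_mul, hgh, leftMul_one] at this
    exact this
  · have := hM.flat_coker
    exact Module.Flat.of_linearEquiv (Submodule.Quotient.equiv _ _ eR hmap).symm

theorem onePlus_mul_onePlus (e e' : R) (ξ η : Matrix (Fin n) (Fin n) (DKR R)) :
    onePlus e ξ * onePlus e' η = 1 + e • ξ + e' • η + (e * e') • (ξ * η) := by
  rw [onePlus, onePlus, mul_add, mul_one, add_mul, one_mul, smul_mul_smul_comm, add_assoc,
    add_assoc, add_assoc]

theorem onePlus_add {e : R} (he : e * e = 0) (ξ η : Matrix (Fin n) (Fin n) (DKR R)) :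
    onePlus e (ξ + η) = onePlus e ξ * onePlus e η := by
  rw [onePlus_mul_onePlus, he, zero_smul, add_zero, onePlus, smul_add, add_assoc]

theorem onePlus_zero (e : R) : onePlus e (0 : Matrix (Fin n) (Fin n) (DKR R)) = 1 := by
  rw [onePlus, smul_zero, add_zero]

theorem onePlus_mul_neg {e : R} (he : e * e = 0) (ξ : Matrix (Fin n) (Fin n) (DKR R)) :
    onePlus e ξ * onePlus e (-ξ) = 1 := by
  rw [← onePlus_add he, add_neg_cancel, onePlus_zero]

theorem onePlus_neg_mul {e : R} (he : e * e = 0) (ξ : Matrix (Fin n) (Fin n) (DKR R)) :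
    onePlus e (-ξ) * onePlus e ξ = 1 := by
  rw [← onePlus_add he, neg_add_cancel, onePlus_zero]

theorem constMat_add (ξ η : DGl n) : constMat R (ξ + η) = constMat R ξ + constMat R η :=
  Matrix.ext fun _ _ => TensorProduct.tmul_add _ _ _

theorem constMat_sub (ξ η : DGl n) : constMat R (ξ - η) = constMat R ξ - constMat R η :=
  Matrix.ext fun _ _ => TensorProduct.tmul_sub _ _ _

theorem constMat_smul (c : ℂ) (ξ : DGl n) : constMat R (c • ξ) = c • constMat R ξ :=
  Matrix.ext fun i j => TensorProduct.tmul_smul c (1 : R) (ξ i j)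

theorem constMat_mul (ξ η : DGl n) : constMat R (ξ * η) = constMat R ξ * constMat R η :=
  Matrix.map_mul (f := (Algebra.TensorProduct.includeRight : DK →ₐ[ℂ] DKR R))

theorem isLieAction (n : ℕ) : IsLieAction n where
  preserves R _ _ e ξ M he hM := hM.map_of_inverse (onePlus_mul_neg he _) (onePlus_neg_mul he _)
  natural R S _ _ _ _ f e ξ M _ _ := by
    rw [infAct, push_map, matMap_onePlus, matMap_constMat]; rfl
  at_zero R _ _ ξ M _ := by
    rw [infAct, onePlus, zero_smul, add_zero, map_leftMul_one]
  add R _ _ e ξ η M he _ := by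
    rw [infAct, infAct, infAct, ← map_leftMul_mul, constMat_add, onePlus_add he]
  smul R _ _ e c ξ M _ _ := by
    rw [infAct, infAct, constMat_smul, onePlus, onePlus, smul_comm, smul_assoc]
  lie R _ _ e e' ξ η M he he' _ := by
    simp only [infAct, ← map_leftMul_mul]
    congr 2
    rw [constMat_sub, constMat_mul, constMat_mul]
    generalize constMat R ξ = x
    generalize constMat R η = y
    -- Expanding `(1 + ee'[x, y])(1 + e'y)(1 + ex)`, every term beyond `ee'` contains `e²` or `e'²`.
    have h1 : e * e' * e = 0 := by rw [mul_right_comm, he, zero_mul]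
    have h2 : e * e' * e' = 0 := by rw [mul_assoc, he', mul_zero]
    have h3 : e * e' * (e * e') = 0 := by rw [← mul_assoc, h1, zero_mul]
    rw [onePlus_mul_onePlus, onePlus_mul_onePlus, mul_comm e' e, onePlus, add_mul, one_mul,
      smul_mul_assoc]
    simp only [mul_add, mul_one, mul_smul_comm, smul_add, smul_smul, h1, h2, h3, zero_smul,
      add_zero, smul_sub]
    abel

end

/-! ### Square-zero thickenings -/

section Thickening

variable {R A : Type} [CommRing R] [Algebra ℂ R] [CommRing A] [Algebra ℂ A] {n : ℕ}

/-- The section `i` exhibits the kernel of `mapD p` as the span of tensors `a ⊗ P` with `p a = 0`.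
-/
theorem sub_mapD_mem_span (i : R →ₐ[ℂ] A) {p : A →ₐ[ℂ] R} (hp : p.comp i = AlgHom.id ℂ R)
    (x : DKR A) : x - mapD i (mapD p x) ∈
      Submodule.span ℂ {y : DKR A | ∃ (a : A) (P : DK), p a = 0 ∧ y = a ⊗ₜ P} := by
  induction x using TensorProduct.induction_on with
  | zero => simp
  | tmul a P =>
    refine Submodule.subset_span ⟨a - i (p a), P, ?_, ?_⟩
    · rw [map_sub, sub_eq_zero]
      exact (DFunLike.congr_fun hp (p a)).symm
    · rw [mapD_tmul, mapD_tmul, TensorProduct.sub_tmul]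
  | add x y hx hy =>
    rw [map_add, map_add, add_sub_add_comm]
    exact add_mem hx hy

theorem mul_eq_zero_of_mapD_eq_zero {i : R →ₐ[ℂ] A} {p : A →ₐ[ℂ] R}
    (hp : p.comp i = AlgHom.id ℂ R) (hsq : ∀ a b : A, p a = 0 → p b = 0 → a * b = 0) {x y : DKR A}
    (hx : mapD p x = 0) (hy : mapD p y = 0) : x * y = 0 := by
  have hx' := sub_mapD_mem_span i hp x
  have hy' := sub_mapD_mem_span i hp y
  rw [hx, map_zero, sub_zero] at hx'
  rw [hy, map_zero, sub_zero] at hy'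
  clear hx hy
  induction hx' using Submodule.span_induction with
  | mem x h =>
    obtain ⟨a, P, ha, rfl⟩ := h
    induction hy' using Submodule.span_induction with
    | mem y h =>
      obtain ⟨b, Q, hb, rfl⟩ := h
      rw [Algebra.TensorProduct.tmul_mul_tmul, hsq a b ha hb, TensorProduct.zero_tmul]
    | zero => rw [mul_zero]
    | add y y' _ _ h h' => rw [mul_add, h, h', add_zero]
    | smul c y _ h => rw [mul_smul_comm, h, smul_zero]
  | zero => rw [zero_mul]
  | add x x' _ _ h h' => rw [add_mul, h, h', add_zero]
  | smul c x _ h => rw [smul_mul_assoc, h, smul_zero]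

theorem matrix_mul_eq_zero_of_matMap_eq_zero {i : R →ₐ[ℂ] A} {p : A →ₐ[ℂ] R}
    (hp : p.comp i = AlgHom.id ℂ R) (hsq : ∀ a b : A, p a = 0 → p b = 0 → a * b = 0)
    {X Y : Matrix (Fin n) (Fin n) (DKR A)} (hX : matMap p X = 0) (hY : matMap p Y = 0) :
    X * Y = 0 := by
  ext a b
  rw [Matrix.mul_apply]
  exact Finset.sum_eq_zero fun j _ => mul_eq_zero_of_mapD_eq_zero hp hsq
    (congrFun (congrFun hX a) j) (congrFun (congrFun hY j) b)

/-- Conjugation by `1 + [δ, E]` carries the approximate idempotent `E` to `E + δ`. -/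
theorem IsIdem.leftMul_mem {k : ℕ} {E δ : Matrix (Fin n) (Fin n) (DKR A)} (hE : IsIdem k E)
    (hE' : IsIdem k (E + δ)) (hδ : ∀ X, δ * X * δ = 0) {v : Fin n → DKR A}
    (hv : v ∈ idemD k E) : leftMul (1 + (δ * E - E * δ)) v ∈ idemD k (E + δ) := by
  have hδneg : Bdd (-k) (-k) δ := by simpa using hE'.neg.sub hE.neg
  have hδpos : Bdd k k δ := by simpa using hE'.pos.sub hE.pos
  have hδδ : δ * δ = 0 := by simpa using hδ 1
  refine ⟨((Bdd.one _).add ((hδneg.mul hE.neg).sub (hE.neg.mul hδneg))) v hv.1, ?_⟩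
  change leftMul (1 - (E + δ)) (leftMul (1 + (δ * E - E * δ)) v) ∈ zD A n k
  -- Everything is expressed through `1 - E`, which is small on `v`, and the defects of `E` and `E +
  -- δ`; the last bracket vanishes because `δ X δ = 0`.
  have e : (1 - (E + δ)) * (1 + (δ * E - E * δ)) = (1 - E) - δ * (1 - E) -
      E * (((E + δ) * (E + δ) - (E + δ)) - (E * E - E)) + (E * E - E) * δ + (E * E - E) * δ +
      (δ * E * δ - δ * δ * E + E * (δ * δ)) := by noncomm_ring
  rw [hδ, hδδ, zero_mul, mul_zero, sub_zero, add_zero, add_zero] at e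
  have h1 : leftMul (1 - E) v ∈ zD A n k := hv.2
  have h2 := (hE.idem.mul hδneg) v hv.1
  rw [← leftMul_mul, e, leftMul_add, leftMul_add, leftMul_sub, leftMul_sub, leftMul_mul δ]
  exact add_mem (add_mem (sub_mem (sub_mem h1 (hδpos _ h1))
    ((hE.pos.mul (hE'.idem.sub hE.idem)) v hv.1)) h2) h2

theorem IsIdem.idemD_add {k : ℕ} {E δ : Matrix (Fin n) (Fin n) (DKR A)} (hE : IsIdem k E)
    (hE' : IsIdem k (E + δ)) (hδ : ∀ X, δ * X * δ = 0) :
    idemD k (E + δ) = (idemD k E).map (leftMul (1 + (δ * E - E * δ))) := by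
  refine le_antisymm (fun v hv => ?_) (Submodule.map_le_iff_le_comap.2 fun v hv =>
    hE.leftMul_mem hE' hδ hv)
  -- The reverse inclusion swaps the roles of `E` and `E + δ`, replacing `δ` by `-δ`. The two
  -- automorphisms are inverse up to terms containing two factors `δ`.
  have hE'' : IsIdem k (E + δ + -δ) := by rwa [add_neg_cancel_right]
  have hδ' : ∀ X, -δ * X * -δ = 0 := fun X => by
    rw [neg_mul, neg_mul, mul_neg, neg_neg, hδ]
  have h := hE'.leftMul_mem hE'' hδ' hv
  rw [add_neg_cancel_right] at h
  refine ⟨_, h, ?_⟩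
  rw [← leftMul_mul]
  have hδδ : δ * δ = 0 := by simpa using hδ 1
  have e : (1 + (δ * E - E * δ)) * (1 + (-δ * (E + δ) - (E + δ) * -δ)) =
      1 - (δ * E * δ) * E + δ * (E * E) * δ + E * (δ * δ) * E - E * (δ * E * δ) := by
    noncomm_ring
  rw [e, hδ, hδ, hδδ]
  simp [leftMul_one]

/-- Points over a square-zero thickening are obtained from constant ones by automorphisms. -/
theorem IsGrD.exists_thickening {i : R →ₐ[ℂ] A} {p : A →ₐ[ℂ] R}
    (hp : p.comp i = AlgHom.id ℂ R) (hsq : ∀ a b : A, p a = 0 → p b = 0 → a * b = 0)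
    {σ : DSub A n} (hσ : IsGrD σ) : ∃ ζ : Matrix (Fin n) (Fin n) (DKR A), matMap p ζ = 0 ∧
      σ = (SatoGr.push i (SatoGr.push p σ)).map (leftMul (1 + ζ)) := by
  obtain ⟨k, E', hE', rfl⟩ := hσ.exists_isIdem
  -- `E` is the constant part of `E'`, so `δ = E' - E` has entries killed by `p` and `δ X δ = 0`;
  -- the automorphism is `1 + [δ, E]`.
  obtain ⟨E, hEdef⟩ : ∃ E, E = matMap i (matMap p E') := ⟨_, rfl⟩
  have hpE : matMap p E = matMap p E' := by rw [hEdef, matMap_comp, hp, matMap_id]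
  have hE : IsIdem k E := hEdef ▸ (hE'.matMap p).matMap i
  obtain ⟨δ, hδ⟩ : ∃ δ, E' = E + δ := ⟨E' - E, (add_sub_cancel _ _).symm⟩
  have hpδ : matMap p δ = 0 := by
    rw [hδ, matMap_add] at hpE
    exact left_eq_add.1 hpE
  refine ⟨δ * E - E * δ, ?_, ?_⟩
  · rw [matMap_sub, matMap_mul, matMap_mul, hpδ, zero_mul, mul_zero, sub_zero]
  · rw [hE'.push_idemD, (hE'.matMap p).push_idemD, ← hEdef, hδ]
    rw [hδ] at hE'
    refine hE.idemD_add hE' fun X => matrix_mul_eq_zero_of_matMap_eq_zero hp hsq ?_ hpδ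
    rw [matMap_mul, hpδ, zero_mul]

end Thickening

/-! ### Tangent vectors -/

section Tangent

variable {R : Type} [CommRing R] [Algebra ℂ R] {n : ℕ}

theorem epsZero_comp_epsIncl : (epsZero R).comp (epsIncl R) = AlgHom.id ℂ R := rfl

theorem epsZero_eps : epsZero R DualNumber.eps = 0 := rfl

theorem tangentVec_isGrD {M : DSub R n} (hM : IsGrD M) (ξ : Matrix (Fin n) (Fin n) (DKR R)) :
    IsGrD (tangentVec ξ M) :=
  (hM.push _).map_of_inverse (onePlus_mul_neg DualNumber.eps_mul_eps _)
    (onePlus_neg_mul DualNumber.eps_mul_eps _)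

theorem push_epsZero_tangentVec (M : DSub R n) (ξ : Matrix (Fin n) (Fin n) (DKR R)) :
    push (epsZero R) (tangentVec ξ M) = M := by
  rw [tangentVec, push_map, push_push, epsZero_comp_epsIncl, push_id, matMap_onePlus, epsZero_eps,
    onePlus, zero_smul, add_zero, map_leftMul_one]

theorem exists_eps_smul (x : DKR (DualNumber R)) : ∃ y : DKR R,
    x - mapD (epsIncl R) (mapD (epsZero R) x) = (DualNumber.eps : DualNumber R) •
      mapD (epsIncl R) y := by
  induction x using TensorProduct.induction_on with
  | zero => exact ⟨0, by simp⟩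
  | tmul a P =>
    refine ⟨TrivSqZeroExt.snd a ⊗ₜ P, ?_⟩
    rw [mapD_tmul, mapD_tmul, mapD_tmul, ← TensorProduct.sub_tmul, TensorProduct.smul_tmul',
      smul_eq_mul]
    congr 1
    refine TrivSqZeroExt.ext ?_ ?_
    · change TrivSqZeroExt.fst a - TrivSqZeroExt.fst a = 0 * TrivSqZeroExt.snd a
      rw [sub_self, zero_mul]
    · change TrivSqZeroExt.snd a - 0 = (0 : R) * 0 + 1 * TrivSqZeroExt.snd a
      rw [sub_zero, zero_mul, zero_add, one_mul]
  | add x y hx hy =>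
    obtain ⟨a, ha⟩ := hx
    obtain ⟨b, hb⟩ := hy
    refine ⟨a + b, ?_⟩
    rw [map_add, map_add, map_add, add_sub_add_comm, ha, hb, smul_add]

theorem epsZero_square_zero (a b : DualNumber R) (ha : epsZero R a = 0) (hb : epsZero R b = 0) :
    a * b = 0 := by
  have ha' : TrivSqZeroExt.fst a = 0 := ha
  have hb' : TrivSqZeroExt.fst b = 0 := hb
  refine TrivSqZeroExt.ext ?_ ?_
  · simp [ha']
  · simp [ha', hb']

/-- Formal transitivity: the automorphism of `exists_thickening` is trivial modulo `ε`, hence of the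
form `1 + εξ`. -/
theorem exists_tangentVec {M : DSub R n} {τ : DSub (DualNumber R) n} (hτ : IsGrD τ)
    (h : push (epsZero R) τ = M) : ∃ ξ, tangentVec ξ M = τ := by
  obtain ⟨ζ, hζ, e⟩ := hτ.exists_thickening (epsZero_comp_epsIncl (R := R)) epsZero_square_zero
  rw [h] at e
  choose ξ hξ using fun a b => exists_eps_smul (ζ a b)
  refine ⟨Matrix.of ξ, ?_⟩
  rw [e, tangentVec, onePlus]
  congr 3
  refine Matrix.ext fun a b => ?_
  have h0 : mapD (epsZero R) (ζ a b) = 0 := congrFun (congrFun hζ a) b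
  have h1 := hξ a b
  rw [h0, map_zero, sub_zero] at h1
  exact h1.symm

theorem exists_tangent_surjective {M : DSub R n} (hM : IsGrD M) :
    ∃ v : Matrix (Fin n) (Fin n) (DKR R) → TangentSpace M,
      (∀ ξ, (v ξ).1 = tangentVec ξ M) ∧ Function.Surjective v :=
  ⟨fun ξ => ⟨tangentVec ξ M, tangentVec_isGrD hM ξ, push_epsZero_tangentVec M ξ⟩, fun _ => rfl,
    fun τ => (exists_tangentVec τ.2.1 τ.2.2).imp fun _ h => Subtype.ext h⟩

/-! ### Continuity -/

/-- Factor `1 + εξ = (1 + εη)(1 + ε(ξ - η))`. The last factor preserves `M[ε]`, since `ξ - η` maps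
`M ⊆ z^{-k} D^n` into `z^k D^n ⊆ M`. -/
theorem tangentVec_le_of_bdd {k : ℕ} {M : DSub R n} (hM : InStratum k M)
    {ξ η : Matrix (Fin n) (Fin n) (DKR R)} (h : Bdd (-k) k (ξ - η)) :
    tangentVec ξ M ≤ tangentVec η M := by
  have h1 : M ≤ zD R n (-k) := fun v hv i => by rw [neg_neg]; exact hM.2 v hv i
  have h2 : zD R n k ≤ M := fun v hv => by
    have := hM.1 _ hv
    simpa only [← mul_assoc, zpowR_mul_zpowR, add_neg_cancel, zpowR_zero, one_mul] using this
  have h3 : ∀ m ∈ push (epsIncl R) M,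
      leftMul (onePlus DualNumber.eps (matMap (epsIncl R) (ξ - η))) m ∈ push (epsIncl R) M := by
    intro m hm
    have h4 := push_mono (epsIncl R) h1 hm
    rw [push_zD] at h4
    have h5 := h.matMap (epsIncl R) m h4
    rw [← push_zD (epsIncl R)] at h5
    rw [onePlus, leftMul_add, leftMul_one, leftMul_smul]
    exact add_mem hm (smul_mem_DSub (push_mono _ h2 h5) _)
  rintro _ ⟨m, hm, rfl⟩
  refine ⟨_, h3 m hm, ?_⟩
  rw [← leftMul_mul, ← onePlus_add DualNumber.eps_mul_eps, ← matMap_add, add_sub_cancel]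

/-- Operators mapping `z^a O` to `z^b O`. -/
def bddOps (a b : ℤ) : Submodule ℂ DK where
  carrier := {P | ∀ f ∈ lat a, act P f ∈ lat b}
  zero_mem' f _ := by rw [map_zero]; exact zero_mem _
  add_mem' hP hQ f hf := by rw [map_add]; exact add_mem (hP f hf) (hQ f hf)
  smul_mem' c P hP f hf := by rw [map_smul]; exact Submodule.smul_mem _ _ (hP f hf)

theorem isOpenSubspace_bddOps (a b : ℤ) : IsOpenSubspace (bddOps a b) := by
  intro m
  -- At most `m` derivations turn `z^a O` into `z^{a-m} O`, and coefficients in `z^{b-a+m} O` make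
  -- up for it.
  refine ⟨b - a + m, Submodule.span_le.2 ?_⟩
  rintro _ ⟨j, hj, g, hg, rfl⟩ f hf
  have h : ∀ j : ℕ, act (ddzD ^ j) f ∈ lat (a - j) := by
    intro j
    induction j with
    | zero => simpa using hf
    | succ j ih =>
      rw [pow_succ', map_mul]
      exact lat_anti (by push_cast; omega) (ddz_mem_lat ih)
  rw [map_mul]
  exact lat_anti (by omega) (mul_mem_lat hg (h j))

theorem isOpen_sub_mem {U : Submodule ℂ DK} (hU : IsOpenSubspace U) (P : DK) :
    IsOpen {Q | Q - P ∈ U} := fun Q hQ =>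
  ⟨U, hU, fun S hS => by
    change Q + S - P ∈ U
    rw [add_sub_right_comm]
    exact add_mem hQ hS⟩

variable (R) in
theorem bdd_constMat {a b : ℤ} {ξ : DGl n} (hξ : ∀ i j, ξ i j ∈ bddOps a b) :
    Bdd a b (constMat R ξ) := by
  refine Bdd.of_matActK fun x hx => mem_latR.2 fun i => ?_
  rw [matActK_apply]
  refine sum_mem fun j _ => ?_
  have hx := mem_latR.1 hx j
  change actK R (1 ⊗ₜ ξ i j) (x j) ∈ _
  generalize x j = y at hx ⊢
  induction hx using latB_induction with
  | tmul f hf => rw [actK_tmul]; exact tmul_mem_latB _ (hξ i j f hf)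
  | add x y _ _ h h' => rw [map_add]; exact add_mem h h'
  | smul r x _ h => rw [map_smul]; exact Submodule.smul_mem _ r h

/-- The neighbourhood, where all entries of `ξ - ξ₀` map `z^{-k} O` to `z^k O`, depends on `k` but
not on `R` or `M`. -/
theorem eventually_tangentVec_eq (k : ℕ) (ξ₀ : DGl n) : ∀ᶠ ξ in nhds ξ₀,
    ∀ (R : Type) [CommRing R] [Algebra ℂ R] (M : DSub R n), IsGrD M → InStratum k M →
      tangentVec (constMat R ξ) M = tangentVec (constMat R ξ₀) M := by
  have h : ∀ᶠ ξ in nhds ξ₀, ∀ i j, ξ i j - ξ₀ i j ∈ bddOps (-k) k := by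
    refine Filter.eventually_all.2 fun i => Filter.eventually_all.2 fun j => ?_
    have hc : Continuous fun ξ : DGl n => ξ i j :=
      (continuous_apply j).comp (continuous_apply i)
    refine hc.continuousAt.eventually_mem (IsOpen.mem_nhds
      (isOpen_sub_mem (isOpenSubspace_bddOps (-k) k) (ξ₀ i j)) ?_)
    change ξ₀ i j - ξ₀ i j ∈ bddOps (-k) k
    rw [sub_self]
    exact zero_mem _
  filter_upwards [h] with ξ hξ R _ _ M _ hM
  refine le_antisymm (tangentVec_le_of_bdd hM ?_) (tangentVec_le_of_bdd hM ?_)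
  · rw [← constMat_sub]
    exact bdd_constMat R hξ
  · rw [← constMat_sub]
    refine bdd_constMat R fun i j => ?_
    rw [Matrix.sub_apply, ← neg_sub]
    exact neg_mem (hξ i j)

end Tangent

/-! ### The tangent space at the unit point -/

section UnitPoint

variable {R : Type} [CommRing R] [Algebra ℂ R] {n : ℕ}

variable (R n) in
theorem isGrD_unitPt : IsGrD (unitPt R n) := by
  have hE : IsIdem 0 (1 : Matrix (Fin n) (Fin n) (DKR R)) :=
    ⟨Bdd.one _, Bdd.one _, fun v _ => by
      rw [mul_one, sub_self]
      have h0 : leftMul (0 : Matrix (Fin n) (Fin n) (DKR R)) v = 0 := Matrix.zero_mulVec v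
      rw [h0]
      exact zero_mem _⟩
  have h : unitPt R n = idemD 0 (1 : Matrix (Fin n) (Fin n) (DKR R)) := by
    rw [unitPt_eq_zD]
    exact le_antisymm hE.zD_le inf_le_left
  exact h ▸ hE.isGrD

theorem leftMul_mem_unitPt {g : Matrix (Fin n) (Fin n) (DKR R)} (hg : ∀ i j, g i j ∈ DOR R)
    {v : Fin n → DKR R} (hv : v ∈ unitPt R n) : leftMul g v ∈ unitPt R n := fun i => by
  rw [leftMul_apply, Matrix.mulVec, dotProduct]
  exact sum_mem fun j _ => mul_mem (hg i j) (hv j)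

/-- Two infinitesimal translates of the unit point agree iff the difference of the translations
has coefficients in `R ⊗ D(O)`. -/
theorem map_unitPt_eq_iff {ζ η : Matrix (Fin n) (Fin n) (DKR R)} (hηζ : η * ζ = 0)
    (hζη : ζ * η = 0) (hη : η * η = 0) (hζ : ζ * ζ = 0) :
    (unitPt R n).map (leftMul (1 + ζ)) = (unitPt R n).map (leftMul (1 + η)) ↔
      ∀ i j, (ζ - η) i j ∈ DOR R := by
  classical
  have key : ∀ {ζ η : Matrix (Fin n) (Fin n) (DKR R)}, η * ζ = 0 → η * η = 0 →
      (∀ i j, (ζ - η) i j ∈ DOR R) →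
      (unitPt R n).map (leftMul (1 + ζ)) ≤ (unitPt R n).map (leftMul (1 + η)) := by
    rintro ζ η hηζ hη h _ ⟨v, hv, rfl⟩
    -- Under the vanishing of products, `(1 + η)(1 + (ζ - η)) = 1 + ζ`.
    refine ⟨leftMul (1 + (ζ - η)) v, ?_, ?_⟩
    · rw [leftMul_add, leftMul_one]
      exact add_mem hv (leftMul_mem_unitPt h hv)
    · rw [← leftMul_mul]
      congr 2
      rw [add_mul, one_mul, mul_add, mul_one, mul_sub, hηζ, hη, sub_self, add_zero]
      abel
  refine ⟨fun h i j => ?_, fun h => le_antisymm (key hηζ hη h) (key hζη hζ fun i j => ?_)⟩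
  -- Testing on the basis vector `e_j` reads off the `j`-th column of `ζ - η`.
  · have hj : (Pi.single j 1 : Fin n → DKR R) ∈ unitPt R n := fun i => by
      rcases eq_or_ne i j with rfl | hij
      · rw [Pi.single_eq_same]; exact one_mem _
      · rw [Pi.single_eq_of_ne hij]; exact zero_mem _
    have h1 := h.le (Submodule.mem_map_of_mem (f := leftMul (1 + ζ)) hj)
    obtain ⟨w, hw, e⟩ := h1
    have h2 : w = leftMul (1 + (ζ - η)) (Pi.single j 1) := by
      have := congrArg (leftMul (1 - η)) e
      rw [← leftMul_mul, ← leftMul_mul] at this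
      have e1 : (1 - η) * (1 + η) = 1 := by
        rw [sub_mul, one_mul, mul_add, mul_one, hη, add_zero, add_sub_cancel_right]
      have e2 : (1 - η) * (1 + ζ) = 1 + (ζ - η) := by
        rw [sub_mul, one_mul, mul_add, mul_one, hηζ, add_zero, add_sub_assoc]
      rwa [e1, leftMul_one, e2] at this
    have h3 := sub_mem (hw i) (hj i)
    rw [h2, leftMul_add, leftMul_one, Pi.add_apply, add_sub_cancel_left, leftMul_apply,
      Matrix.mulVec_single_one] at h3
    exact h3
  · rw [← neg_sub, Matrix.neg_apply]
    exact neg_mem (h i j)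

/-- The `ε`-coefficient of an operator over the dual numbers. -/
def sndD : DKR (DualNumber ℂ) →ₗ[ℂ] DK :=
  TensorProduct.lift ((LinearMap.lsmul ℂ DK).comp (TrivSqZeroExt.sndHom ℂ ℂ))

theorem sndD_tmul (a : DualNumber ℂ) (P : DK) : sndD (a ⊗ₜ P) = TrivSqZeroExt.snd a • P := rfl

theorem eps_tmul_mem_DOR_iff {P : DK} :
    (DualNumber.eps : DualNumber ℂ) ⊗ₜ P ∈ DOR (DualNumber ℂ) ↔ P ∈ DO := by
  refine ⟨fun h => ?_, fun h => tmul_mem_DOR _ h⟩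
  have : ∀ x ∈ DOR (DualNumber ℂ), sndD x ∈ DO := by
    intro x hx
    induction hx using DOR_induction with
    | tmul r P hP => rw [sndD_tmul]; exact Subalgebra.smul_mem _ hP _
    | add x y _ _ h h' => rw [map_add]; exact add_mem h h'
  have := this _ h
  rwa [sndD_tmul, DualNumber.snd_eps, one_smul] at this

theorem tangentVec_unitPt (ξ : Matrix (Fin n) (Fin n) (DKR R)) :
    tangentVec ξ (unitPt R n) = (unitPt (DualNumber R) n).map
      (leftMul (1 + (DualNumber.eps : DualNumber R) • matMap (epsIncl R) ξ)) := by
  rw [tangentVec, push_unitPt, onePlus]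

theorem smul_mul_smul_eq_zero {a b : R} (h : a * b = 0) (X Y : Matrix (Fin n) (Fin n) (DKR R)) :
    (a • X) * (b • Y) = 0 := by
  rw [smul_mul_smul_comm, h, zero_smul]

theorem tangentVec_unitPt_eq_iff (ξ η : DGl n) :
    tangentVec (constMat ℂ ξ) (unitPt ℂ n) = tangentVec (constMat ℂ η) (unitPt ℂ n) ↔
      ∀ i j, ξ i j - η i j ∈ DO := by
  have h := fun X Y : Matrix (Fin n) (Fin n) (DKR (DualNumber ℂ)) =>
    smul_mul_smul_eq_zero DualNumber.eps_mul_eps X Y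
  rw [tangentVec_unitPt, tangentVec_unitPt, map_unitPt_eq_iff (h _ _) (h _ _) (h _ _) (h _ _)]
  refine forall_congr' fun i => forall_congr' fun j => ?_
  rw [← smul_sub, ← matMap_sub, ← constMat_sub, matMap_constMat, ← eps_tmul_mem_DOR_iff]
  change (DualNumber.eps : DualNumber ℂ) • ((1 : DualNumber ℂ) ⊗ₜ[ℂ] (ξ i j - η i j)) ∈ _ ↔ _
  rw [TensorProduct.smul_tmul', smul_eq_mul, mul_one]

theorem exists_constMat_eq (ξ : Matrix (Fin n) (Fin n) (DKR ℂ)) : ∃ η : DGl n,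
    constMat ℂ η = ξ := by
  have : ∀ x : DKR ℂ, ∃ P : DK, (1 : ℂ) ⊗ₜ P = x := by
    intro x
    induction x using TensorProduct.induction_on with
    | zero => exact ⟨0, TensorProduct.tmul_zero _ _⟩
    | tmul r P => exact ⟨r • P, by
        rw [TensorProduct.tmul_smul, TensorProduct.smul_tmul', smul_eq_mul, mul_one]⟩
    | add x y hx hy =>
      obtain ⟨P, rfl⟩ := hx
      obtain ⟨Q, rfl⟩ := hy
      exact ⟨P + Q, TensorProduct.tmul_add _ _ _⟩
  choose η hη using fun i j => this (ξ i j)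
  exact ⟨Matrix.of η, Matrix.ext hη⟩

variable (n) in
/-- The tangent vector at the unit point given by a matrix of operators. -/
def unitTangent (ξ : DGl n) : TangentSpace (unitPt ℂ n) :=
  ⟨tangentVec (constMat ℂ ξ) (unitPt ℂ n), tangentVec_isGrD (isGrD_unitPt ℂ n) _,
    push_epsZero_tangentVec _ _⟩

theorem unitTangent_eq_iff (ξ η : DGl n) :
    unitTangent n ξ = unitTangent n η ↔ ∀ i j, ξ i j - η i j ∈ DO :=
  Subtype.ext_iff.trans (tangentVec_unitPt_eq_iff ξ η)

theorem unitTangent_surjective : Function.Surjective (unitTangent n) := fun τ => by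
  obtain ⟨ξ, hξ⟩ := exists_tangentVec τ.2.1 τ.2.2
  obtain ⟨η, rfl⟩ := exists_constMat_eq ξ
  exact ⟨η, Subtype.ext hξ⟩

theorem unitTangent_map_out (ξ : DGl n) :
    unitTangent n ((ξ.map (Submodule.Quotient.mk (p := Subalgebra.toSubmodule DO))).map
      Quotient.out) = unitTangent n ξ := by
  refine (unitTangent_eq_iff _ _).2 fun i j => ?_
  exact (Submodule.Quotient.eq (Subalgebra.toSubmodule DO)).1
    (Quotient.out_eq (Submodule.Quotient.mk (p := Subalgebra.toSubmodule DO) (ξ i j)))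

variable (n) in
/-- `D(K)/D(O) ⊗ gl_n` is the tangent space at the unit point. -/
def unitTangentEquiv : Matrix (Fin n) (Fin n) (DK ⧸ Subalgebra.toSubmodule DO) ≃
    TangentSpace (unitPt ℂ n) :=
  Equiv.ofBijective (fun x => unitTangent n (x.map Quotient.out)) <| by
    refine ⟨fun x y h => Matrix.ext fun i j => ?_, fun τ => ?_⟩
    · have := (Submodule.Quotient.eq (Subalgebra.toSubmodule DO)).2
        ((unitTangent_eq_iff _ _).1 h i j)
      exact (Quotient.out_eq (x i j)).symm.trans (this.trans (Quotient.out_eq (y i j)))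
    · obtain ⟨ξ, rfl⟩ := unitTangent_surjective τ
      exact ⟨_, unitTangent_map_out ξ⟩

theorem unitTangentEquiv_mk (ξ : DGl n) :
    unitTangentEquiv n (ξ.map Submodule.Quotient.mk) = unitTangent n ξ := unitTangent_map_out ξ

theorem exists_mk_eq (x : Matrix (Fin n) (Fin n) (DK ⧸ Subalgebra.toSubmodule DO)) :
    ∃ ξ : DGl n, ξ.map Submodule.Quotient.mk = x :=
  ⟨x.map Quotient.out, Matrix.ext fun i j => Quotient.out_eq (x i j)⟩

/-! ### The linear structure -/

theorem isTangentSMul_unitTangent (c : ℂ) (ξ : DGl n) :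
    IsTangentSMul c (unitTangent n ξ) (unitTangent n (c • ξ)) := by
  change push (epsScale ℂ c) (tangentVec _ _) = tangentVec _ _
  rw [tangentVec_unitPt, tangentVec_unitPt, push_map, push_unitPt, matMap_add, matMap_one,
    matMap_smul, matMap_constMat, matMap_constMat, matMap_constMat, constMat_smul]
  have : epsScale ℂ c DualNumber.eps = c • DualNumber.eps := by
    refine (TrivSqZeroExt.map_inr _ _).trans (TrivSqZeroExt.ext ?_ ?_)
    · simp
    · simp
  rw [this, smul_assoc, smul_comm]

/-- The two infinitesimals of `R[ε₁, ε₂]`. -/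
def epsOne : TrivSqZeroExt ℂ (ℂ × ℂ) := TrivSqZeroExt.inr (1, 0)

/-- The second infinitesimal. -/
def epsTwo : TrivSqZeroExt ℂ (ℂ × ℂ) := TrivSqZeroExt.inr (0, 1)

theorem epsPair_inr (a b : ℂ) (v : ℂ × ℂ) :
    epsPair ℂ a b (TrivSqZeroExt.inr v) = (a * v.1 + b * v.2) • DualNumber.eps := by
  refine (TrivSqZeroExt.map_inr _ _).trans ?_
  refine TrivSqZeroExt.ext ?_ ?_
  · simp
  · simp

/-- `R[ε₁, ε₂] → R`. -/
def pairZero : TrivSqZeroExt ℂ (ℂ × ℂ) →ₐ[ℂ] ℂ := TrivSqZeroExt.fstHom ℂ ℂ (ℂ × ℂ)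

/-- `R → R[ε₁, ε₂]`. -/
def pairIncl : ℂ →ₐ[ℂ] TrivSqZeroExt ℂ (ℂ × ℂ) := TrivSqZeroExt.inlAlgHom ℂ ℂ (ℂ × ℂ)

/-- `ε ↦ a ε₁ + b ε₂`. -/
def epsDiag (a b : ℂ) : DualNumber ℂ →ₐ[ℂ] TrivSqZeroExt ℂ (ℂ × ℂ) :=
  TrivSqZeroExt.map (R' := ℂ) (a • LinearMap.inl ℂ ℂ ℂ + b • LinearMap.inr ℂ ℂ ℂ)

theorem epsDiag_eps (a b : ℂ) : epsDiag a b DualNumber.eps = TrivSqZeroExt.inr (a, b) := by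
  refine (TrivSqZeroExt.map_inr _ _).trans ?_
  congr 1
  simp

theorem pairZero_comp_pairIncl : pairZero.comp pairIncl = AlgHom.id ℂ ℂ := rfl

theorem pairZero_square_zero (a b : TrivSqZeroExt ℂ (ℂ × ℂ)) (ha : pairZero a = 0)
    (hb : pairZero b = 0) : a * b = 0 := by
  have ha' : TrivSqZeroExt.fst a = 0 := ha
  have hb' : TrivSqZeroExt.fst b = 0 := hb
  refine TrivSqZeroExt.ext ?_ ?_
  · simp [ha']
  · simp [ha', hb']

/-- The ideal `(ε₁, ε₂)` is the direct sum of its two lines, so an operator over it is rebuilt from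
its restrictions to the axes. This gives uniqueness in the addition of tangent vectors. -/
theorem eq_epsDiag_add {x : DKR (TrivSqZeroExt ℂ (ℂ × ℂ))} (hx : mapD pairZero x = 0) :
    x = mapD (epsDiag 1 0) (mapD (epsPair ℂ 1 0) x) +
      mapD (epsDiag 0 1) (mapD (epsPair ℂ 0 1) x) := by
  have h := sub_mapD_mem_span pairIncl pairZero_comp_pairIncl x
  rw [hx, map_zero, sub_zero] at h
  clear hx
  induction h using Submodule.span_induction with
  | mem x h =>
    obtain ⟨a, P, ha, rfl⟩ := h
    simp only [mapD_tmul]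
    rw [← TensorProduct.add_tmul]
    congr 1
    obtain ⟨v, rfl⟩ : ∃ v, a = TrivSqZeroExt.inr v :=
      ⟨TrivSqZeroExt.snd a, TrivSqZeroExt.ext ha rfl⟩
    rw [epsPair_inr, epsPair_inr, map_smul, map_smul, epsDiag_eps, epsDiag_eps]
    refine TrivSqZeroExt.ext ?_ ?_
    · simp
    · simp
  | zero => simp
  | add x y _ _ h h' =>
    simp only [map_add]
    nth_rewrite 1 [h, h']
    abel
  | smul c x _ h =>
    simp only [map_smul]
    nth_rewrite 1 [h]
    rw [smul_add]

/-- The common extension is `(1 + ε₁ξ + ε₂η) D^n`. Any competitor is `(1 + ζ') D^n` by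
`exists_thickening`, and `ζ' - ζ` has coefficients in `D(O)` because both its restrictions do. -/
theorem isTangentAdd_unitTangent (ξ η : DGl n) :
    IsTangentAdd (unitTangent n ξ) (unitTangent n η) (unitTangent n (ξ + η)) := by
  obtain ⟨ζ, hζ⟩ : ∃ ζ : Matrix (Fin n) (Fin n) (DKR (TrivSqZeroExt ℂ (ℂ × ℂ))),
      ζ = epsOne • constMat _ ξ + epsTwo • constMat _ η := ⟨_, rfl⟩
  have hpair : ∀ a b : ℂ, matMap (epsPair ℂ a b) ζ =
      (DualNumber.eps : DualNumber ℂ) • constMat _ (a • ξ + b • η) := by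
    intro a b
    rw [hζ, matMap_add, matMap_smul, matMap_smul, matMap_constMat, matMap_constMat, epsOne, epsTwo,
      epsPair_inr, epsPair_inr, constMat_add, constMat_smul, constMat_smul, smul_add]
    simp only [mul_one, mul_zero, add_zero, zero_add, smul_assoc]
    rw [smul_comm a, smul_comm b]
  have hzero : matMap pairZero ζ = 0 := by
    rw [hζ, matMap_add, matMap_smul, matMap_smul]
    have h1 : pairZero epsOne = 0 := rfl
    have h2 : pairZero epsTwo = 0 := rfl
    rw [h1, h2, zero_smul, zero_smul, add_zero]
  have hmul : ∀ X Y : Matrix (Fin n) (Fin n) (DKR (TrivSqZeroExt ℂ (ℂ × ℂ))),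
      matMap pairZero X = 0 → matMap pairZero Y = 0 → X * Y = 0 := fun X Y =>
    matrix_mul_eq_zero_of_matMap_eq_zero pairZero_comp_pairIncl pairZero_square_zero
  have hpush : ∀ a b : ℂ, push (epsPair ℂ a b)
      ((unitPt (TrivSqZeroExt ℂ (ℂ × ℂ)) n).map (leftMul (1 + ζ))) =
        (unitTangent n (a • ξ + b • η)).1 := by
    intro a b
    rw [push_map, push_unitPt, matMap_add, matMap_one, hpair]
    refine Eq.trans ?_ (tangentVec_unitPt _).symm
    rw [matMap_constMat]
  have hinv : (1 + ζ) * (1 - ζ) = 1 := by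
    rw [mul_sub, mul_one, add_mul, one_mul, hmul ζ ζ hzero hzero, add_zero, add_sub_cancel_right]
  have hinv' : (1 - ζ) * (1 + ζ) = 1 := by
    rw [mul_add, mul_one, sub_mul, one_mul, hmul ζ ζ hzero hzero, sub_zero, sub_add_cancel]
  have h10 : push (epsPair ℂ 1 0) ((unitPt (TrivSqZeroExt ℂ (ℂ × ℂ)) n).map (leftMul (1 + ζ))) =
      (unitTangent n ξ).1 := by rw [hpush, one_smul, zero_smul, add_zero]
  have h01 : push (epsPair ℂ 0 1) ((unitPt (TrivSqZeroExt ℂ (ℂ × ℂ)) n).map (leftMul (1 + ζ))) =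
      (unitTangent n η).1 := by rw [hpush, one_smul, zero_smul, zero_add]
  refine ⟨(unitPt _ n).map (leftMul (1 + ζ)), ⟨(isGrD_unitPt _ n).map_of_inverse hinv hinv', h10,
    h01⟩, fun σ' hσ' h1 h2 => ?_, by rw [hpush, one_smul, one_smul]⟩
  obtain ⟨ζ', hζ', e⟩ := hσ'.exists_thickening pairZero_comp_pairIncl pairZero_square_zero
  have h0 : push pairZero σ' = unitPt ℂ n := by
    have hcomp : pairZero = (epsZero ℂ).comp (epsPair ℂ 1 0) := by
      refine AlgHom.ext fun a => ?_
      exact (TrivSqZeroExt.fst_map _ a).symm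
    rw [hcomp, ← push_push, h1]
    exact (unitTangent n ξ).2.2
  rw [h0, push_unitPt] at e
  rw [e, map_unitPt_eq_iff (hmul _ _ hzero hζ') (hmul _ _ hζ' hzero) (hmul _ _ hzero hzero)
    (hmul _ _ hζ' hζ')]
  -- Equality of restrictions along `f` is converted by `map_unitPt_eq_iff`, now over the dual
  -- numbers, into a condition on the entries of `ζ' - ζ`.
  have hz : ∀ f : TrivSqZeroExt ℂ (ℂ × ℂ) →ₐ[ℂ] DualNumber ℂ,
      (∀ a, epsZero ℂ (f a) = pairZero a) →
      push f σ' = push f ((unitPt (TrivSqZeroExt ℂ (ℂ × ℂ)) n).map (leftMul (1 + ζ))) →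
      ∀ i j, mapD f ((ζ' - ζ) i j) ∈ DOR (DualNumber ℂ) := by
    intro f hf h i j
    have hf' : (epsZero ℂ).comp f = pairZero := AlgHom.ext hf
    have hm : ∀ X Y : Matrix (Fin n) (Fin n) (DKR (TrivSqZeroExt ℂ (ℂ × ℂ))),
        matMap pairZero X = 0 → matMap pairZero Y = 0 → matMap f X * matMap f Y = 0 := by
      intro X Y hX hY
      rw [← matMap_mul, hmul X Y hX hY]
      exact Matrix.ext fun _ _ => map_zero (mapD f)
    rw [e, push_map, push_map, push_unitPt, matMap_add, matMap_add, matMap_one, map_unitPt_eq_iff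
      (hm _ _ hzero hζ') (hm _ _ hζ' hzero) (hm _ _ hzero hzero) (hm _ _ hζ' hζ'),
      ← matMap_sub] at h
    exact h i j
  intro i j
  have hx : mapD pairZero ((ζ' - ζ) i j) = 0 := by
    have : matMap pairZero (ζ' - ζ) = 0 := by rw [matMap_sub, hζ', hzero, sub_zero]
    exact congrFun (congrFun this i) j
  rw [eq_epsDiag_add hx]
  exact add_mem
    (mapD_mem_DOR _ (hz _ (fun a => TrivSqZeroExt.fst_map _ a) (h1.trans h10.symm) i j))
    (mapD_mem_DOR _ (hz _ (fun a => TrivSqZeroExt.fst_map _ a) (h2.trans h01.symm) i j))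

end UnitPoint

end SatoGr

end

/-! ### Assembly of the five statements -/

theorem mainTheorem5 (n : ℕ) :
    -- the fiber is the thin Sato Grassmannian of `K^n`
    SatoGr.IsSatoIdentification n ∧
    -- `D(K) ⊗ gl_n` acts on it
    SatoGr.IsLieAction n ∧
    -- continuously: on each stratum, the vector field of `ξ` depends locally constantly on `ξ`
    (∀ (k : ℕ) (ξ₀ : SatoGr.DGl n), ∀ᶠ ξ in nhds ξ₀,
      ∀ (R : Type) [CommRing R] [Algebra ℂ R] (M : SatoGr.DSub R n),
        SatoGr.IsGrD M → SatoGr.InStratum k M →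
        SatoGr.tangentVec (SatoGr.constMat R ξ) M = SatoGr.tangentVec (SatoGr.constMat R ξ₀) M) ∧
    -- formally transitively: `R ⊗ D(K) ⊗ gl_n` maps onto the tangent space at each `R`-point
    (∀ (R : Type) [CommRing R] [Algebra ℂ R] (M : SatoGr.DSub R n), SatoGr.IsGrD M →
      ∃ v : Matrix (Fin n) (Fin n) (SatoGr.DKR R) → SatoGr.TangentSpace M,
        (∀ ξ, (v ξ).1 = SatoGr.tangentVec ξ M) ∧ Function.Surjective v) ∧
    -- inducing an isomorphism of `D(K)/D(O) ⊗ gl_n` with the tangent space at `D^n`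
    SatoGr.IsGrD (SatoGr.unitPt ℂ n) ∧
    ∃ Φ : Matrix (Fin n) (Fin n) (SatoGr.DK ⧸ Subalgebra.toSubmodule SatoGr.DO) ≃
        SatoGr.TangentSpace (SatoGr.unitPt ℂ n),
      (∀ ξ : SatoGr.DGl n, (Φ (ξ.map (Submodule.Quotient.mk))).1 =
        SatoGr.tangentVec (SatoGr.constMat ℂ ξ) (SatoGr.unitPt ℂ n)) ∧
      (∀ x y, SatoGr.IsTangentAdd (Φ x) (Φ y) (Φ (x + y))) ∧
      (∀ (c : ℂ) x, SatoGr.IsTangentSMul c (Φ x) (Φ (c • x))) := by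
  refine ⟨SatoGr.isSatoIdentification n, SatoGr.isLieAction n, SatoGr.eventually_tangentVec_eq,
    fun R _ _ M hM => SatoGr.exists_tangent_surjective hM, SatoGr.isGrD_unitPt ℂ n,
    SatoGr.unitTangentEquiv n, fun ξ => ?_, fun x y => ?_, fun c x => ?_⟩
  · rw [SatoGr.unitTangentEquiv_mk]; rfl
  · obtain ⟨ξ, rfl⟩ := SatoGr.exists_mk_eq x
    obtain ⟨η, rfl⟩ := SatoGr.exists_mk_eq y
    have h : ξ.map (Submodule.Quotient.mk (p := Subalgebra.toSubmodule SatoGr.DO)) +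
        η.map Submodule.Quotient.mk = (ξ + η).map Submodule.Quotient.mk := rfl
    rw [h, SatoGr.unitTangentEquiv_mk, SatoGr.unitTangentEquiv_mk, SatoGr.unitTangentEquiv_mk]
    exact SatoGr.isTangentAdd_unitTangent ξ η
  · obtain ⟨ξ, rfl⟩ := SatoGr.exists_mk_eq x
    have h : c • ξ.map (Submodule.Quotient.mk (p := Subalgebra.toSubmodule SatoGr.DO)) =
        (c • ξ).map Submodule.Quotient.mk := rfl
    rw [h, SatoGr.unitTangentEquiv_mk, SatoGr.unitTangentEquiv_mk]
    exact SatoGr.isTangentSMul_unitTangent c ξ
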